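/- **Notation.** Let $\langle\xi\rangle=(1+|\xi|^2)^{1/2}$ and $\widehat u(\xi)=\int_{\mathbb R^n} e^{-i\langle x,\xi\rangle}u(x)\,dx$, extended to $\mathcal S'(\mathbb R^n)$. - $\mathcal K_{pol}(\mathbb R^n)$ is the set of positive measurable functions $k$ on $\mathbb R^n$ for which there are constants $C,N>0$ with $k(\xi+\eta)\le C\langle\xi\rangle^{N}k(\eta)$ for all $\xi,\eta\in\mathbb R^n$. - $\mathcal K_a(\mathbb R^n)$ is the set of $k\in\mathcal K_{pol}(\mathbb R^n)$ for which there is a constant $C>0$ with $\frac1{k^2}*\frac1{k^2}\le\frac{C^2}{k^2}$ on $\mathbb R^n$. - For $k\in\mathcal K_{pol}(\mathbb R^n)$, $\mathcal B_k(\mathbb R^n)$ is the space of $u\in\mathcal S'(\mathbb R^n)$ such that $\widehat u$ is a function and $\|u\|_{\mathcal B_k}=\|k\widehat u\|_{L^2}<\infty$ (put $\|u\|_{\mathcal B_k}=\infty$ for all other $u \in \mathcal S'(\mathbb R^n)$). - $\mathcal B_k^\infty(\mathbb R^n)$ is the space of distributions $u\in\mathcal D'(\mathbb R^n)$ such that $\|u\|_{k,\infty,\chi}=\sup_{y\in\mathbb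 R^n}\|u\,\chi(\cdot-y)\|_{\mathcal B_k}<\infty$ for some $\chi\in C_0^\infty(\mathbb R^n)\setminus\{0\}$. It carries the norm $\|\cdot\|_{k,\infty,\chi}$ for any $\chi\in C_0^\infty(\mathbb R^n)\setminus\{0\}$; neither the space nor its topology depends on $\chi$. **Theorem (Wiener–Lévy for $\mathcal B_k^\infty$, weak form).** Let $\Omega\subset\mathbb C^d$ be open and let $\Phi:\Omega\to\mathbb C$ be holomorphic. Let $k\in\mathcal K_{pol}(\mathbb R^n)$ and $k'\in\mathcal K_a(\mathbb R^n)$ be such that $k'(\xi)/k(\xi)\to0$ as $\xi\to\infty$ and $1/k'\in L^2(\mathbb R^n)$. Then every element of $\mathcal B_k^\infty(\mathbb R^n)$ is given by a unique continuous function, with which it is identified, and the following holds. (a) If $u=(u_1,\dots,u_d)\in\mathcal B_k^\infty(\mathbb R^n)^d$ satisfies $\overline{u(\mathbb R^n)}\subset\Omega$, then $\Phi\circ u=\Phi(u)\in\mathcal B_{k'}^\infty(\mathbb R^n)$. (b) If $u,u_\varepsilon\in\mathcal B_k^\infty(\mathbb R^n)^d$ for $0<\varepsilon\le1$, $\overline{u(\mathbb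 R^n)}\subset\Omega$, and $u_\varepsilon\to u$ in $\mathcal B_{k'}^\infty(\mathbb R^n)^d$ as $\varepsilon\to0$, then there is $\varepsilon_0\in(0,1]$ such that $\overline{u_\varepsilon(\mathbb R^n)}\subset\Omega$ for every $0<\varepsilon\le\varepsilon_0$, and $\Phi(u_\varepsilon)\to\Phi(u)$ in $\mathcal B_{k'}^\infty(\mathbb R^n)$ as $\varepsilon\to0$. -/

import Mathlib

open MeasureTheory Filter Topology
open scoped Distributions SchwartzMap FourierTransform ENNReal ContDiff

noncomputable section

namespace WienerLevy

/-- The Euclidean space `ℝⁿ`. -/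
abbrev Sp (n : ℕ) : Type := EuclideanSpace ℝ (Fin n)

/-- The space `C₀^∞(ℝⁿ)` of complex-valued test functions with its usual inductive limit
topology. -/
abbrev Test (n : ℕ) : Type := 𝓓((⊤ : TopologicalSpace.Opens (Sp n)), ℂ)

/-- The space `𝒟'(ℝⁿ)` of complex distributions: continuous complex linear forms on
`C₀^∞(ℝⁿ)`. -/
abbrev Distr (n : ℕ) : Type := Test n →L[ℂ] ℂ

variable {n : ℕ}

/-! ### Weight functions -/

/-- `⟨ξ⟩ = (1 + |ξ|²)^{1/2}`. -/
def bracket (ξ : Sp n) : ℝ := Real.sqrt (1 + ‖ξ‖ ^ 2)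

/-- The class `𝒦_pol(ℝⁿ)` of weight functions of polynomial growth. -/
def IsKpol (k : Sp n → ℝ) : Prop :=
  Measurable k ∧ (∀ ξ, 0 < k ξ) ∧
    ∃ C N : ℝ, 0 < C ∧ 0 < N ∧ ∀ ξ η, k (ξ + η) ≤ C * bracket ξ ^ N * k η

/-- The class `𝒦_a(ℝⁿ)`: weights of polynomial growth such that
`(1/k²) * (1/k²) ≤ C²/k²` pointwise for some constant `C`. The convolution of nonnegative
functions is written as a Lebesgue integral with values in `[0, ∞]`, so that its finiteness
is part of the condition. -/
def IsKa (k : Sp n → ℝ) : Prop :=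
  IsKpol k ∧ ∃ C : ℝ, 0 < C ∧ ∀ ξ,
    ∫⁻ η, ENNReal.ofReal (1 / k η ^ 2) * ENNReal.ofReal (1 / k (ξ - η) ^ 2) ≤
      ENNReal.ofReal (C ^ 2 / k ξ ^ 2)

/-! ### The Fourier transformation, normalized as `û(ξ) = ∫ e^{-i⟨x,ξ⟩} u(x) dx` -/

/-- The dilation `x ↦ (2π)⁻¹ x`. -/
def dilation (n : ℕ) : Sp n ≃L[ℝ] Sp n :=
  ContinuousLinearEquiv.smulLeft (Units.mk0 ((2 * Real.pi)⁻¹ : ℝ) (by positivity))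

/-- The Fourier transform of a Schwartz function without `2π` in the exponent, obtained from
the transform `𝓕` with exponent `-2πi⟨x,ξ⟩` by a dilation; see `fourierS_apply`. -/
def fourierS (φ : 𝓢(Sp n, ℂ)) : 𝓢(Sp n, ℂ) :=
  SchwartzMap.compCLMOfContinuousLinearEquiv ℂ (dilation n) (𝓕 φ)

theorem fourierS_apply (φ : 𝓢(Sp n, ℂ)) (ξ : Sp n) :
    fourierS φ ξ = ∫ x, Complex.exp (-(Complex.I * (inner ℝ x ξ : ℝ))) * φ x := by
  change (𝓕 φ : 𝓢(Sp n, ℂ)) (((2 * Real.pi)⁻¹ : ℝ) • ξ) = _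
  rw [SchwartzMap.fourier_coe, Real.fourier_eq']
  refine integral_congr_ae (Eventually.of_forall fun x => ?_)
  simp only [smul_eq_mul, inner_smul_right]
  congr 2
  have h : (Real.pi : ℂ) ≠ 0 := by exact_mod_cast Real.pi_ne_zero
  push_cast
  field_simp

/-- `û = g`: the Fourier transform of the tempered distribution `T` is the function `g`, that
is `⟨û, φ⟩ = ⟨T, φ̂⟩ = ∫ g φ` for all Schwartz functions `φ`. Such a `g` is locally integrable
and unique up to equality almost everywhere. -/
def HasFourier (T : 𝓢'(Sp n, ℂ)) (g : Sp n → ℂ) : Prop :=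
  AEStronglyMeasurable g volume ∧
    ∀ φ : 𝓢(Sp n, ℂ), Integrable (fun ξ => g ξ * φ ξ) volume ∧
      T (fourierS φ) = ∫ ξ, g ξ * φ ξ

/-- The norm `‖T‖_{ℬ_k} = ‖k T̂‖_{L²}` with values in `[0, ∞]`; it is `∞` if `T̂` is not a
function or if `k T̂` is not in `L²`. So `ℬ_k = B_{2,k}` is the set of all `T ∈ 𝒮'` for which it
is finite. For a weight `k` of polynomial growth, `k g ∈ L²` implies that `g φ` is integrable for
every Schwartz function `φ`. The infimum is over a set with at most one value. -/
def bNorm (k : Sp n → ℝ) (T : 𝓢'(Sp n, ℂ)) : ℝ≥0∞ :=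
  ⨅ (g : Sp n → ℂ) (_ : HasFourier T g), eLpNorm (fun ξ => (k ξ : ℂ) * g ξ) 2 volume

/-! ### Products of distributions and test functions -/

/-- The translate `τ_y χ = χ(· - y)`. -/
def translate (y : Sp n) (χ : Test n) : Test n where
  toFun x := χ (x - y)
  contDiff' := χ.contDiff.comp (contDiff_id.sub contDiff_const)
  hasCompactSupport' := χ.hasCompactSupport.comp_homeomorph (Homeomorph.subRight y)
  tsupport_subset' := fun _ _ => trivial

/-- The compact set `supp χ`. -/
def suppC (χ : Test n) : TopologicalSpace.Compacts (Sp n) := ⟨tsupport χ, χ.hasCompactSupport⟩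

theorem Test.hasTemperateGrowth (χ : Test n) : Function.HasTemperateGrowth (χ : Sp n → ℂ) :=
  χ.hasCompactSupport.hasTemperateGrowth χ.contDiff

/-- `φ ↦ χ φ` as a linear map from `𝒮` to the smooth functions supported in `supp χ`. -/
def mulSupportedLM (χ : Test n) : 𝓢(Sp n, ℂ) →ₗ[ℂ] 𝓓_{suppC χ}(Sp n, ℂ) where
  toFun φ := ContDiffMapSupportedIn.of_support_subset (f := fun x => χ x * φ x)
    (χ.contDiff.mul (φ.smooth ⊤))
    ((Function.support_mul_subset_left _ _).trans subset_closure)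
  map_add' φ ψ := by
    ext x
    exact mul_add (χ x) (φ x) (ψ x)
  map_smul' c φ := by
    ext x
    exact mul_left_comm (χ x) c (φ x)

theorem continuous_mulSupportedLM (χ : Test n) : Continuous (mulSupportedLM χ) := by
  refine WithSeminorms.continuous_of_continuous_comp
    (ContDiffMapSupportedIn.withSeminorms ℂ (Sp n) ℂ ⊤ (suppC χ)) _ fun i => ?_
  let q : Seminorm ℂ 𝓢(Sp n, ℂ) := (SchwartzMap.seminorm ℂ 0 i).comp
    (SchwartzMap.smulLeftCLM ℂ (χ : Sp n → ℂ)).toLinearMap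
  have hcont : Continuous q :=
    ((schwartz_withSeminorms ℂ (Sp n) ℂ).continuous_seminorm (0, i)).comp
      (SchwartzMap.smulLeftCLM ℂ (χ : Sp n → ℂ)).continuous
  refine Seminorm.continuous_of_le (q := q) hcont fun φ => ?_
  refine (ContDiffMapSupportedIn.seminorm_top_le_iff ℂ (apply_nonneg _ _) i _).2 fun x _ => ?_
  have hfun : ((mulSupportedLM χ φ : 𝓓_{suppC χ}(Sp n, ℂ)) : Sp n → ℂ) =
      (SchwartzMap.smulLeftCLM ℂ (χ : Sp n → ℂ) φ : 𝓢(Sp n, ℂ)) := by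
    funext x
    exact (SchwartzMap.smulLeftCLM_apply_apply (Test.hasTemperateGrowth χ) φ x).symm
  rw [hfun]
  exact SchwartzMap.norm_iteratedFDeriv_le_seminorm ℂ _ i x

/-- `φ ↦ χ φ` as a continuous linear map from `𝒮(ℝⁿ)` to `C₀^∞(ℝⁿ)`. -/
def mulTest (χ : Test n) : 𝓢(Sp n, ℂ) →L[ℂ] Test n :=
  (TestFunction.ofSupportedInCLM ℂ (Ω := ⊤) (K := suppC χ) (fun _ _ => trivial)).comp
    ⟨mulSupportedLM χ, continuous_mulSupportedLM χ⟩

theorem mulTest_apply (χ : Test n) (φ : 𝓢(Sp n, ℂ)) (x : Sp n) :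
    mulTest χ φ x = χ x * φ x := rfl

/-- The product `χ u` of a distribution and a test function, as a (compactly supported) tempered
distribution: `⟨χ u, φ⟩ = ⟨u, χ φ⟩`. -/
def cutoff (χ : Test n) (u : Distr n) : 𝓢'(Sp n, ℂ) :=
  ContinuousLinearMap.toPointwiseConvergenceCLM ℂ (RingHom.id ℂ) _ _ (u.comp (mulTest χ))

theorem cutoff_apply (χ : Test n) (u : Distr n) (φ : 𝓢(Sp n, ℂ)) :
    cutoff χ u φ = u (mulTest χ φ) := rfl

/-! ### The spaces `ℬ_k^∞` -/

/-- `‖u‖_{k,∞,χ} = sup_y ‖u τ_y χ‖_{ℬ_k}`, with values in `[0, ∞]`. -/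
def ulNorm (k : Sp n → ℝ) (χ : Test n) (u : Distr n) : ℝ≥0∞ :=
  ⨆ y : Sp n, bNorm k (cutoff (translate y χ) u)

/-- `u ∈ ℬ_k^∞(ℝⁿ)`. -/
def MemBInf (k : Sp n → ℝ) (u : Distr n) : Prop :=
  ∃ χ : Test n, χ ≠ 0 ∧ ulNorm k χ u < ⊤

/-- The distribution `φ ↦ ∫ φ f` defined by a locally integrable function `f`. -/
def ofFun (f : Sp n → ℂ) : Distr n :=
  TestFunction.integralAgainstBilinCLM (ContinuousLinearMap.mul ℂ ℂ) volume f

/-- The `d`-tuple of distributions `u` is given by the continuous function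
`f = (f₁, …, f_d) : ℝⁿ → ℂ^d`. -/
def IsContRep {d : ℕ} (u : Fin d → Distr n) (f : Sp n → Fin d → ℂ) : Prop :=
  Continuous f ∧ ∀ j, u j = ofFun fun x => f x j

end WienerLevy

end

open WienerLevy

/-!
The weight `k'` in `𝒦_a` makes the functions with Fourier transform in `L²(k'² dξ)` a Banach
algebra, of continuous functions because `1 / k'` is in `L²`. Its elements of small norm have
sup norm below one, and `1 - w` is inverted by the Neumann series.

Let `w` be a window equal to one on the support of a window `χ`. Cutting off the Fourier transform
of `w u` at a high frequency gives a smooth function `v` with bounds on all derivatives that are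
uniform in the position of the window; since `k' / k → 0`, the error `w u - v` is small in the
algebra. Cauchy's formula on a small torus around `v(x)` gives
`χ Φ(u) = (2π)^{-d} ∫ χ Φ(v + ζ) ∏ⱼ (1 - ζⱼ⁻¹ (w uⱼ - vⱼ))⁻¹ dθ` with `ζⱼ = r e^{iθⱼ}`.
Here `χ Φ(v + ζ)` is a test function with uniform bounds and the product is a convergent Neumann
series, so that the integrand is bounded in the algebra, and depends on `u` in a Lipschitz way with
respect to the norm of `k'`. To average over `θ` without measurability of `θ ↦` integrand as a map
into the algebra, membership with norm at most `M` is described through the evaluation vectors of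
a Hilbert space, which makes it stable under integrals of pointwise values.
-/

noncomputable section

namespace WienerLevy

section Polydisc

open Metric Complex

variable {d : ℕ} {E : Type*} [NormedAddCommGroup E] [NormedSpace ℂ E]

theorem dist_torusMap_apply (c : Fin d → ℂ) (R θ : Fin d → ℝ) (j : Fin d) :
    dist (torusMap c R θ j) (c j) = |R j| := by
  simp [torusMap, dist_eq_norm, norm_exp_ofReal_mul_I]

theorem continuous_torusMap (c : Fin d → ℂ) (R : Fin d → ℝ) : Continuous (torusMap c R) := by
  unfold torusMap
  fun_prop

theorem torusMap_mem_pi_closedBall (c : Fin d → ℂ) {R : Fin d → ℝ} (hR : ∀ j, 0 ≤ R j)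
    (θ : Fin d → ℝ) : torusMap c R θ ∈ Set.univ.pi fun j => closedBall (c j) (R j) := fun j _ => by
  rw [mem_closedBall, dist_torusMap_apply, abs_of_nonneg (hR j)]

theorem continuous_comp_add_torusMap {X : Type*} [TopologicalSpace X] {c : Fin d → ℂ}
    {R : Fin d → ℝ} {F : (Fin d → ℂ) → X}
    (hF : ContinuousOn F (Set.univ.pi fun j => closedBall (c j) (R j))) (hR : ∀ j, 0 ≤ R j) :
    Continuous fun θ => F (c + torusMap 0 R θ) := by
  refine hF.comp_continuous (continuous_const.add (continuous_torusMap 0 R)) fun θ => ?_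
  rw [← torusMap_sub_center c, add_sub_cancel]
  exact torusMap_mem_pi_closedBall c hR θ

theorem torusMap_apply_ne {c w : Fin d → ℂ} {R : Fin d → ℝ} (hw : ∀ j, w j ∈ ball (c j) (R j))
    (θ : Fin d → ℝ) (j : Fin d) : torusMap c R θ j ≠ w j := fun h => by
  have hlt : |R j| < R j := by rw [← dist_torusMap_apply c R θ j, h]; exact hw j
  exact (le_abs_self _).not_gt hlt

theorem torusIntegrable_prod_sub_inv_smul {c w : Fin d → ℂ} {R : Fin d → ℝ}
    (hw : ∀ j, w j ∈ ball (c j) (R j)) {F : (Fin d → ℂ) → E}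
    (hF : ContinuousOn F (Set.univ.pi fun j => closedBall (c j) (R j))) :
    TorusIntegrable (fun ζ => (∏ j, (ζ j - w j)⁻¹) • F ζ) c R := by
  have hR : ∀ j, 0 ≤ R j := fun j => (pos_of_mem_ball (hw j)).le
  refine Continuous.integrableOn_Icc (.smul ?_ ?_)
  · refine continuous_finsetProd _ fun j _ => Continuous.inv₀ ?_ fun θ => ?_
    · exact ((continuous_apply j).comp (continuous_torusMap c R)).sub continuous_const
    · exact sub_ne_zero.2 (torusMap_apply_ne hw θ j)
  · exact hF.comp_continuous (continuous_torusMap c R) (torusMap_mem_pi_closedBall c hR)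

variable [CompleteSpace E]

theorem torusIntegral_prod_sub_inv_smul {c w : Fin d → ℂ} {R : Fin d → ℝ}
    (hw : ∀ j, w j ∈ ball (c j) (R j)) {F : (Fin d → ℂ) → E}
    (hF : DifferentiableOn ℂ F (Set.univ.pi fun j => closedBall (c j) (R j))) :
    torusIntegral (fun ζ => (∏ j, (ζ j - w j)⁻¹) • F ζ) c R = (2 * Real.pi * I : ℂ) ^ d • F w := by
  induction d with
  | zero => rw [torusIntegral_dim0, Subsingleton.elim c w]; simp
  | succ d ih =>
    have cons_mem : ∀ (z : ℂ) (y : Fin d → ℂ), z ∈ closedBall (c 0) (R 0) →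
        (y ∈ Set.univ.pi fun j : Fin d => closedBall (c j.succ) (R j.succ)) →
        (Fin.cons z y : Fin (d + 1) → ℂ) ∈ Set.univ.pi fun j => closedBall (c j) (R j) :=
      fun z y hz hy j _ => Fin.cases hz (fun i => hy i trivial) j
    have integral_last : ∀ z ∈ sphere (c 0) (R 0),
        torusIntegral (fun y : Fin d → ℂ =>
          (∏ j, ((Fin.cons z y : Fin (d + 1) → ℂ) j - w j)⁻¹) • F (Fin.cons z y))
          (c ∘ Fin.succ) (R ∘ Fin.succ) =
        (z - w 0)⁻¹ • (2 * Real.pi * I : ℂ) ^ d • F (Fin.cons z (Fin.tail w)) := by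
      intro z hz
      have hFz : DifferentiableOn ℂ (fun y : Fin d → ℂ => F (Fin.cons z y))
          (Set.univ.pi fun j : Fin d => closedBall (c j.succ) (R j.succ)) :=
        hF.comp ((differentiableOn_const z).finCons differentiableOn_id)
          fun y hy => cons_mem z y (sphere_subset_closedBall hz) hy
      rw [← ih (c := c ∘ Fin.succ) (R := R ∘ Fin.succ) (w := Fin.tail w) (fun j => hw j.succ) hFz,
        ← torusIntegral_smul]
      simp only [Fin.prod_univ_succ, Fin.cons_zero, Fin.cons_succ, smul_smul, Fin.tail]
    have hF₀ : DifferentiableOn ℂ (fun z : ℂ => (2 * Real.pi * I : ℂ) ^ d •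
        F (Fin.cons z (Fin.tail w))) (closedBall (c 0) (R 0)) := by
      refine (hF.comp (differentiableOn_id.finCons (differentiableOn_const _))
        fun z hz => ?_).const_smul _
      exact cons_mem z _ hz fun j _ => ball_subset_closedBall (hw j.succ)
    rw [torusIntegral_succ (torusIntegrable_prod_sub_inv_smul hw hF.continuousOn),
      circleIntegral.integral_congr (pos_of_mem_ball (hw 0)).le integral_last,
      hF₀.circleIntegral_sub_inv_smul (hw 0), Fin.cons_self_tail, smul_smul, pow_succ']

/-- The Cauchy integral formula on a polydisc as a mean value over the torus; unlike the form with
the kernel `∏ (ζ j - w j)⁻¹`, it does not move the circles of integration when `c` varies. -/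
theorem eq_integral_torus_prod_smul {R : Fin d → ℝ} {c h : Fin d → ℂ} (hh : ∀ j, ‖h j‖ < R j)
    {F : (Fin d → ℂ) → E}
    (hF : DifferentiableOn ℂ F (Set.univ.pi fun j => closedBall (c j) (R j))) :
    F (c + h) = ((2 * Real.pi : ℂ) ^ d)⁻¹ • ∫ θ in Set.Icc (0 : Fin d → ℝ) (fun _ => 2 * Real.pi),
      (∏ j, (1 - (torusMap 0 R θ j)⁻¹ * h j)⁻¹) • F (c + torusMap 0 R θ) := by
  have cauchy := torusIntegral_prod_sub_inv_smul (w := c + h) (c := c) (R := R)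
    (fun j => by simpa [dist_eq_norm] using hh j) hF
  have kernel_eq : ∀ (θ : Fin d → ℝ), (∏ j, (R j : ℂ) * exp (θ j * I) * I) *
      ∏ j, (torusMap c R θ j - (c + h) j)⁻¹ =
        I ^ d * ∏ j, (1 - (torusMap 0 R θ j)⁻¹ * h j)⁻¹ := fun θ => by
    rw [← Finset.prod_mul_distrib, ← Fin.prod_const, ← Finset.prod_mul_distrib]
    refine Finset.prod_congr rfl fun j _ => ?_
    have hR : (R j : ℂ) ≠ 0 := by exact_mod_cast ((norm_nonneg _).trans_lt (hh j)).ne'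
    have hζ : (R j : ℂ) * exp (θ j * I) ≠ 0 := mul_ne_zero hR (exp_ne_zero _)
    have hsub : torusMap c R θ j - (c + h) j =
        R j * exp (θ j * I) * (1 - (R j * exp (θ j * I))⁻¹ * h j) := by
      rw [mul_sub, mul_inv_cancel_left₀ hζ]
      simp [torusMap]
    rw [hsub, mul_inv, mul_right_comm, mul_inv_cancel_left₀ hζ, mul_comm]
    simp [torusMap]
  have hI : (I : ℂ) ^ d ≠ 0 := pow_ne_zero _ I_ne_zero
  have hπ : (2 * Real.pi : ℂ) ^ d ≠ 0 := pow_ne_zero _ (by simp [Real.pi_ne_zero])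
  simp only [torusIntegral, smul_smul, kernel_eq] at cauchy
  simp only [mul_pow _ I, mul_comm _ (I ^ d), mul_smul, integral_smul] at cauchy
  rw [eq_inv_smul_iff₀ hπ, ← smul_right_injective E hI cauchy]
  simp only [← torusMap_sub_center c, add_sub_cancel]

end Polydisc

section Smooth

open Metric

variable {d : ℕ} {E : Type*} [NormedAddCommGroup E] [NormedSpace ℂ E]

theorem isBoundedLinearMap_integral_smul {X : Type*} [TopologicalSpace X] [CompactSpace X]
    [MeasurableSpace X] [BorelSpace X] {μ : Measure X} {g : X → E} (hg : Integrable g μ) :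
    IsBoundedLinearMap ℂ fun φ : C(X, ℂ) => ∫ x, φ x • g x ∂μ := by
  have integrable_smul : ∀ φ : C(X, ℂ), Integrable (fun x => φ x • g x) μ := fun φ =>
    hg.bdd_smul _ φ.continuous.aestronglyMeasurable (.of_forall φ.norm_coe_le_norm)
  refine IsLinearMap.with_bound ⟨fun φ ψ => ?_, fun z φ => ?_⟩ (∫ x, ‖g x‖ ∂μ) fun φ => ?_
  · simp only [ContinuousMap.add_apply, add_smul]
    exact integral_add (integrable_smul φ) (integrable_smul ψ)
  · simp only [ContinuousMap.smul_apply, smul_assoc, integral_smul]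
  · rw [mul_comm, ← integral_const_mul]
    refine norm_integral_le_of_norm_le (hg.norm.const_mul _) (.of_forall fun x => ?_)
    rw [norm_smul]
    gcongr
    exact φ.norm_coe_le_norm x

theorem ringInverse_continuousMap_apply {X : Type*} [TopologicalSpace X]
    {φ : C(X, ℂ)} (hφ : ∀ x, φ x ≠ 0) (x : X) : Ring.inverse φ x = (φ x)⁻¹ := by
  refine eq_inv_of_mul_eq_one_right ?_
  rw [← ContinuousMap.mul_apply, Ring.mul_inverse_cancel _
    (ContinuousMap.isUnit_iff_forall_ne_zero φ |>.2 hφ), ContinuousMap.one_apply]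

theorem one_sub_inv_mul_ne_zero {z ζ : ℂ} (h : ‖z‖ < ‖ζ‖) : 1 - ζ⁻¹ * z ≠ 0 := by
  have hζ : ζ ≠ 0 := norm_pos_iff.1 ((norm_nonneg z).trans_lt h)
  rw [← inv_mul_cancel₀ hζ, ← mul_sub]
  exact mul_ne_zero (inv_ne_zero hζ) (sub_ne_zero.2 fun h' => h.ne' (congrArg norm h'))

theorem contDiffAt_prod_ringInverse_one_sub_smul {𝕜 ι A : Type*} [NontriviallyNormedField 𝕜]
    [Fintype ι] [NormedCommRing A] [NormedAlgebra 𝕜 A] [CompleteSpace A] (a : ι → A) (c : ι → 𝕜)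
    {m : WithTop ℕ∞} :
    ContDiffAt 𝕜 m (fun w : ι → 𝕜 => ∏ j, Ring.inverse (1 - (w - c) j • a j)) c := by
  refine contDiffAt_prod fun j _ => ContDiffAt.comp (g := Ring.inverse)
    (f := fun w : ι → 𝕜 => 1 - (w - c) j • a j) c ?_ (by fun_prop)
  simpa using contDiffAt_ringInverse 𝕜 (1 : Aˣ)

variable [CompleteSpace E]

/-- In the Cauchy formula the point `w` enters only through inverses in the Banach algebra of
continuous functions on the parameter cube of the torus, and inversion there is analytic. -/
theorem contDiffOn_of_differentiableOn_pi {F : (Fin d → ℂ) → E} {U : Set (Fin d → ℂ)}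
    (hU : IsOpen U) (hF : DifferentiableOn ℂ F U) (m : WithTop ℕ∞) : ContDiffOn ℂ m F U := by
  refine fun c hc => ContDiffAt.contDiffWithinAt ?_
  obtain ⟨r, hr, hrU⟩ := nhds_basis_closedBall.mem_iff.1 (hU.mem_nhds hc)
  let R : Fin d → ℝ := fun _ => r
  have hFR : DifferentiableOn ℂ F (Set.univ.pi fun j => closedBall (c j) (R j)) :=
    hF.mono (by rwa [← closedBall_pi c hr.le])
  let K := Set.Icc (0 : Fin d → ℝ) fun _ => 2 * Real.pi
  have : CompactSpace K := isCompact_iff_compactSpace.1 isCompact_Icc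
  have ne_zero : ∀ θ j, torusMap 0 R θ j ≠ 0 := fun θ j =>
    torusMap_apply_ne (c := 0) (w := 0) (fun _ => mem_ball_self hr) θ j
  let a : Fin d → C(K, ℂ) := fun j => ⟨fun θ => (torusMap 0 R θ j)⁻¹,
    (((continuous_apply j).comp (continuous_torusMap 0 R)).inv₀ fun θ => ne_zero θ j).comp
      continuous_subtype_val⟩
  let ν : Measure K := volume.comap Subtype.val
  have integrable_F : Integrable (fun θ : K => F (c + torusMap 0 R θ)) ν := by
    have hcont := continuous_comp_add_torusMap hFR.continuousOn fun _ => hr.le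
    exact (integrableOn_iff_comap_subtypeVal measurableSet_Icc).1 hcont.integrableOn_Icc
  have formula : F =ᶠ[𝓝 c] fun w => ((2 * Real.pi : ℂ) ^ d)⁻¹ • ∫ θ : K,
      (∏ j, Ring.inverse (1 - (w - c) j • a j)) θ • F (c + torusMap 0 R θ) ∂ν := by
    filter_upwards [ball_mem_nhds c hr] with w hw
    have hw' : ∀ j, ‖(w - c) j‖ < R j := (pi_norm_lt_iff hr).1 (mem_ball_iff_norm.1 hw)
    have kernel_apply : ∀ (θ : K) j, Ring.inverse (1 - (w - c) j • a j) θ =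
        (1 - (torusMap 0 R θ j)⁻¹ * (w - c) j)⁻¹ := fun θ j => by
      have norm_torusMap : ∀ θ, ‖torusMap 0 R θ j‖ = R j := fun θ => by
        rw [← dist_zero_right]
        exact (dist_torusMap_apply 0 R θ j).trans (abs_of_pos hr)
      rw [ringInverse_continuousMap_apply fun θ => ?_]
      · simp [a, mul_comm]
      · simpa [a, mul_comm] using one_sub_inv_mul_ne_zero ((hw' j).trans_eq (norm_torusMap θ).symm)
    have cauchy := eq_integral_torus_prod_smul hw' hFR
    rw [add_sub_cancel, ← integral_subtype_comap measurableSet_Icc] at cauchy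
    simp only [ContinuousMap.prod_apply, kernel_apply]
    exact cauchy
  refine ContDiffAt.congr_of_eventuallyEq ?_ formula
  exact ((isBoundedLinearMap_integral_smul integrable_F).contDiff.contDiffAt.comp c
    (contDiffAt_prod_ringInverse_one_sub_smul a c)).const_smul _

end Smooth

section FeatureMap

variable {𝕜 X H : Type*} [RCLike 𝕜] [NormedAddCommGroup H] [InnerProductSpace 𝕜 H]

/-- The function `f` belongs to the reproducing kernel Hilbert space with feature map `ψ`, with
norm at most `M`. Carrying the bound as a parameter lets sums, limits and averages be estimated
without choosing the representing vectors. -/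
def FeatureRep (ψ : X → H) (f : X → 𝕜) (M : ℝ) : Prop :=
  ∃ β : H, ‖β‖ ≤ M ∧ ∀ x, f x = inner 𝕜 (ψ x) β

namespace FeatureRep

variable {ψ : X → H} {f g : X → 𝕜} {M N : ℝ}

theorem nonneg (h : FeatureRep ψ f M) : 0 ≤ M :=
  let ⟨β, hβ, _⟩ := h
  (norm_nonneg β).trans hβ

theorem zero (ψ : X → H) : FeatureRep ψ (fun _ => (0 : 𝕜)) 0 :=
  ⟨0, norm_zero.le, fun _ => (inner_zero_right _).symm⟩

theorem const_mul (c : 𝕜) (h : FeatureRep ψ f M) :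
    FeatureRep ψ (fun x => c * f x) (‖c‖ * M) := by
  obtain ⟨β, hβ, hf⟩ := h
  refine ⟨c • β, ?_, fun x => by simp only [inner_smul_right, hf]⟩
  rw [norm_smul]
  gcongr

theorem add (hf : FeatureRep ψ f M) (hg : FeatureRep ψ g N) :
    FeatureRep ψ (fun x => f x + g x) (M + N) := by
  obtain ⟨β, hβ, hf⟩ := hf
  obtain ⟨γ, hγ, hg⟩ := hg
  exact ⟨β + γ, norm_add_le_of_le hβ hγ, fun x => by simp only [inner_add_right, hf, hg]⟩

theorem norm_linearCombination_le (h : FeatureRep ψ f M) (c : X →₀ 𝕜) :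
    ‖Finsupp.linearCombination 𝕜 (fun x => starRingEnd 𝕜 (f x)) c‖ ≤
      M * ‖Finsupp.linearCombination 𝕜 ψ c‖ := by
  obtain ⟨β, hβ, hf⟩ := h
  have : Finsupp.linearCombination 𝕜 (fun x => starRingEnd 𝕜 (f x)) c =
      inner 𝕜 β (Finsupp.linearCombination 𝕜 ψ c) := by
    simp only [Finsupp.linearCombination_apply, Finsupp.sum, inner_sum, inner_smul_right,
      smul_eq_mul, hf, inner_conj_symm]
  rw [this]
  exact (norm_inner_le_norm _ _).trans (by gcongr)

variable [CompleteSpace H]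

/-- The inequality makes `ψ x ↦ conj (f x)` a well-defined bounded functional on the span of
the range of `ψ`; extend it by Hahn–Banach and represent it by a vector. -/
theorem of_forall_norm_le (hM : 0 ≤ M)
    (h : ∀ c : X →₀ 𝕜, ‖Finsupp.linearCombination 𝕜 (fun x => starRingEnd 𝕜 (f x)) c‖ ≤
      M * ‖Finsupp.linearCombination 𝕜 ψ c‖) : FeatureRep ψ f M := by
  let T : (X →₀ 𝕜) →ₗ[𝕜] H := Finsupp.linearCombination 𝕜 ψ
  let F : (X →₀ 𝕜) →ₗ[𝕜] 𝕜 := Finsupp.linearCombination 𝕜 fun x => starRingEnd 𝕜 (f x)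
  have norm_F_le : ∀ c, ‖F c‖ ≤ M * ‖T c‖ := h
  have hker : T.ker ≤ F.ker := fun c hc => by
    simpa [LinearMap.mem_ker.1 hc] using norm_F_le c
  let φ : T.range →ₗ[𝕜] 𝕜 := T.ker.liftQ F hker ∘ₗ T.quotKerEquivRange.symm
  have φ_apply : ∀ c (hc : T c ∈ T.range), φ ⟨T c, hc⟩ = F c := fun c hc => by
    have : (⟨T c, hc⟩ : T.range) = T.quotKerEquivRange (T.ker.mkQ c) := rfl
    simp [φ, this]
  have φ_bound : ∀ v, ‖φ v‖ ≤ M * ‖v‖ := by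
    rintro ⟨v, hv⟩
    obtain ⟨c, rfl⟩ := LinearMap.mem_range.1 hv
    rw [φ_apply]
    exact norm_F_le c
  obtain ⟨g, hg, norm_g⟩ := exists_extension_norm_eq T.range (φ.mkContinuous M φ_bound)
  refine ⟨(InnerProductSpace.toDual 𝕜 H).symm g, ?_, fun x => ?_⟩
  · rw [LinearIsometryEquiv.norm_map, norm_g]
    exact φ.mkContinuous_norm_le hM φ_bound
  · have hx : T (Finsupp.single x 1) = ψ x := by simp [T]
    have g_apply : g (ψ x) = starRingEnd 𝕜 (f x) := by
      rw [← hx]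
      refine (hg ⟨_, LinearMap.mem_range_self T _⟩).trans ((φ_apply _ _).trans ?_)
      simp [F]
    rw [← inner_conj_symm, InnerProductSpace.toDual_symm_apply, g_apply, RCLike.conj_conj]

theorem of_tendsto {ι : Type*} {l : Filter ι} [l.NeBot] {F : ι → X → 𝕜}
    (hF : ∀ i, FeatureRep ψ (F i) M) (hlim : ∀ x, Tendsto (fun i => F i x) l (𝓝 (f x))) :
    FeatureRep ψ f M := by
  obtain ⟨i₀⟩ : Nonempty ι := l.nonempty_of_neBot
  refine of_forall_norm_le (hF i₀).nonneg fun c => ?_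
  refine le_of_tendsto (x := l) (Tendsto.norm ?_)
    (Eventually.of_forall fun i => (hF i).norm_linearCombination_le c)
  simp only [Finsupp.linearCombination_apply, Finsupp.sum]
  exact tendsto_finsetSum _ fun x _ =>
    ((RCLike.continuous_conj.tendsto _).comp (hlim x)).const_smul _

theorem integral {Θ : Type*} [MeasurableSpace Θ] {μ : Measure Θ} {F : Θ → X → 𝕜} {M : Θ → ℝ}
    (hF : ∀ θ, FeatureRep ψ (F θ) (M θ)) (hM : Integrable M μ)
    (hint : ∀ x, Integrable (fun θ => F θ x) μ) :
    FeatureRep ψ (fun x => ∫ θ, F θ x ∂μ) (∫ θ, M θ ∂μ) := by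
  refine of_forall_norm_le (integral_nonneg fun θ => (hF θ).nonneg) fun c => ?_
  have comb_integral : Finsupp.linearCombination 𝕜 (fun x => starRingEnd 𝕜 (∫ θ, F θ x ∂μ)) c =
      ∫ θ, Finsupp.linearCombination 𝕜 (fun x => starRingEnd 𝕜 (F θ x)) c ∂μ := by
    simp only [Finsupp.linearCombination_apply, Finsupp.sum]
    rw [integral_finsetSum _ fun x _ => ?_]
    · simp only [integral_smul, integral_conj]
    · refine Integrable.smul (c x) ?_
      exact (RCLike.conjCLE (K := 𝕜)).toContinuousLinearMap.integrable_comp (hint x)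
  rw [comb_integral, ← integral_mul_const]
  exact norm_integral_le_of_norm_le (hM.mul_const _)
    (Eventually.of_forall fun θ => (hF θ).norm_linearCombination_le c)

end FeatureRep

end FeatureMap

variable {n : ℕ}

section Synthesis

/-- The character `x ↦ e^{i⟨x,ξ⟩}`. -/
def expI (x ξ : Sp n) : ℂ := Complex.exp (Complex.I * (inner ℝ x ξ : ℝ))

@[simp] theorem norm_expI (x ξ : Sp n) : ‖expI x ξ‖ = 1 := by
  rw [expI, mul_comm, Complex.norm_exp_ofReal_mul_I]

@[fun_prop] theorem continuous_expI : Continuous fun p : Sp n × Sp n => expI p.1 p.2 := by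
  unfold expI; fun_prop

@[fun_prop] theorem continuous_expI_right (x : Sp n) : Continuous (expI x) := by
  unfold expI; fun_prop

@[fun_prop] theorem continuous_expI_left (ξ : Sp n) : Continuous fun x => expI x ξ := by
  unfold expI; fun_prop

theorem expI_comm (x ξ : Sp n) : expI x ξ = expI ξ x := by
  rw [expI, expI, real_inner_comm]

theorem expI_add_left (x y ξ : Sp n) : expI (x + y) ξ = expI x ξ * expI y ξ := by
  rw [expI, expI, expI, ← Complex.exp_add, inner_add_left]; push_cast; ring_nf

theorem expI_mul_expI_sub (x ξ η : Sp n) : expI x η * expI x (ξ - η) = expI x ξ := by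
  rw [expI_comm x η, expI_comm x (ξ - η), ← expI_add_left, add_sub_cancel, expI_comm]

/-- The inverse Fourier transform `x ↦ ∫ e^{i⟨x,ξ⟩} a(ξ) dξ`, without the factor `(2π)^{-n}`. -/
def synth (a : Sp n → ℂ) (x : Sp n) : ℂ := ∫ ξ, expI x ξ * a ξ

variable {a b : Sp n → ℂ}

theorem synth_congr_ae (h : a =ᵐ[volume] b) : synth a = synth b := funext fun x =>
  integral_congr_ae (h.mono fun ξ hξ => by simp only [hξ])

theorem integrable_expI_mul (ha : Integrable a) (x : Sp n) :
    Integrable fun ξ => expI x ξ * a ξ :=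
  ha.bdd_mul (c := 1) (by fun_prop) (Eventually.of_forall fun ξ => (norm_expI x ξ).le)

theorem norm_synth_le (a : Sp n → ℂ) (x : Sp n) : ‖synth a x‖ ≤ ∫ ξ, ‖a ξ‖ :=
  (norm_integral_le_integral_norm _).trans_eq (by simp only [norm_mul, norm_expI, one_mul])

theorem continuous_synth (ha : Integrable a) : Continuous (synth a) :=
  continuous_of_dominated (bound := fun ξ => ‖a ξ‖)
    (fun x => (integrable_expI_mul ha x).aestronglyMeasurable)
    (fun x => Eventually.of_forall fun ξ => by rw [norm_mul, norm_expI, one_mul]) ha.norm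
    (Eventually.of_forall fun ξ => by fun_prop)

theorem synth_mul_synth (ha : Integrable a) (hb : Integrable b) (x : Sp n) :
    synth a x * synth b x = synth (fun ξ => ∫ η, a η * b (ξ - η)) x := by
  have h := integral_convolution (ContinuousLinearMap.mul ℂ ℂ) (integrable_expI_mul ha x)
    (integrable_expI_mul hb x)
  simp only [ContinuousLinearMap.mul_apply', convolution_def] at h
  rw [synth, synth, ← h, synth]
  refine integral_congr_ae (Eventually.of_forall fun ξ => ?_)
  simp only [← integral_const_mul]
  refine integral_congr_ae (Eventually.of_forall fun η => ?_)
  simp only [← expI_mul_expI_sub x ξ η]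
  ring

theorem expI_mul_synth (a : Sp n → ℂ) (x η : Sp n) :
    expI x η * synth a x = synth (fun ξ => a (ξ - η)) x := by
  rw [synth, synth, ← integral_const_mul,
    ← integral_sub_right_eq_self (fun ξ => expI x η * (expI x ξ * a ξ)) η]
  simp only [← mul_assoc, expI_mul_expI_sub]

end Synthesis

section Weights

/-- A positive measurable function with reciprocal in `L²`, the requirement under which every
function with Fourier transform in `L²(k² dξ)` is continuous. -/
structure IsL2Weight (k : Sp n → ℝ) : Prop where
  measurable : Measurable k
  pos : ∀ ξ, 0 < k ξ
  memLp : MemLp (fun ξ => 1 / k ξ) 2 volume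

/-- The norm of `1 / k` in `L²`. -/
def invNorm (k : Sp n → ℝ) : ℝ := (eLpNorm (fun ξ => 1 / k ξ) 2 volume).toReal

theorem invNorm_nonneg (k : Sp n → ℝ) : 0 ≤ invNorm k := ENNReal.toReal_nonneg

namespace IsL2Weight

variable {k : Sp n → ℝ} {a : Sp n → ℂ} {M : ℝ}

theorem ofReal_ne_zero (hk : IsL2Weight k) (ξ : Sp n) : (k ξ : ℂ) ≠ 0 := by
  exact_mod_cast (hk.pos ξ).ne'

theorem enorm_ofReal (hk : IsL2Weight k) (ξ : Sp n) : ‖(k ξ : ℂ)‖ₑ = ENNReal.ofReal (k ξ) := by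
  rw [← ofReal_norm, Complex.norm_real, Real.norm_of_nonneg (hk.pos ξ).le]

theorem aestronglyMeasurable_ofReal (hk : IsL2Weight k) :
    AEStronglyMeasurable (fun ξ => (k ξ : ℂ)) :=
  (Complex.measurable_ofReal.comp hk.measurable).aestronglyMeasurable

theorem eLpNorm_one_le (hk : IsL2Weight k) (ha : AEStronglyMeasurable a) :
    eLpNorm a 1 ≤ ENNReal.ofReal (invNorm k) * eLpNorm (fun ξ => (k ξ : ℂ) * a ξ) 2 := by
  have ha_eq : a = (fun ξ => 1 / k ξ) • (fun ξ => (k ξ : ℂ) * a ξ) := by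
    funext ξ
    simp [hk.ofReal_ne_zero ξ]
  conv_lhs => rw [ha_eq]
  rw [invNorm, ENNReal.ofReal_toReal hk.memLp.eLpNorm_ne_top]
  exact eLpNorm_smul_le_mul_eLpNorm (r := 1) (hk.aestronglyMeasurable_ofReal.mul ha)
    hk.memLp.aestronglyMeasurable

theorem integrable (hk : IsL2Weight k) (ha : AEStronglyMeasurable a)
    (hM : eLpNorm (fun ξ => (k ξ : ℂ) * a ξ) 2 ≤ ENNReal.ofReal M) : Integrable a := by
  refine memLp_one_iff_integrable.1 ⟨ha, (hk.eLpNorm_one_le ha).trans_lt ?_⟩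
  exact ENNReal.mul_lt_top ENNReal.ofReal_lt_top (hM.trans_lt ENNReal.ofReal_lt_top)

theorem integral_norm_le (hk : IsL2Weight k) (ha : AEStronglyMeasurable a) (hM₀ : 0 ≤ M)
    (hM : eLpNorm (fun ξ => (k ξ : ℂ) * a ξ) 2 ≤ ENNReal.ofReal M) :
    ∫ ξ, ‖a ξ‖ ≤ invNorm k * M := by
  rw [integral_norm_eq_lintegral_enorm ha, ← eLpNorm_one_eq_lintegral_enorm]
  refine ENNReal.toReal_le_of_le_ofReal (mul_nonneg (invNorm_nonneg k) hM₀) ?_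
  rw [ENNReal.ofReal_mul (invNorm_nonneg k)]
  exact (hk.eLpNorm_one_le ha).trans (mul_le_mul_right hM _)

end IsL2Weight

end Weights

section FourierRep

/-- The function `f` is `x ↦ ∫ e^{i⟨x,ξ⟩} a(ξ) dξ` for some `a` with `‖k a‖_{L²} ≤ M`; so `f`
belongs to `ℬ_k` with norm at most `(2π)^n M`. -/
def FourierRep (k : Sp n → ℝ) (f : Sp n → ℂ) (M : ℝ) : Prop :=
  0 ≤ M ∧ ∃ a : Sp n → ℂ, AEStronglyMeasurable a ∧
    eLpNorm (fun ξ => (k ξ : ℂ) * a ξ) 2 ≤ ENNReal.ofReal M ∧ f = synth a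

variable {k : Sp n → ℝ} {f g : Sp n → ℂ} {M N : ℝ}

theorem memLp_conj_expI_mul_inv (hk : IsL2Weight k) (x : Sp n) :
    MemLp (fun ξ => starRingEnd ℂ (expI x ξ) * ((1 / k ξ : ℝ) : ℂ)) 2 := by
  refine (hk.memLp.ofReal (K := ℂ)).of_le_mul (c := 1) ?_ (Eventually.of_forall fun ξ => ?_)
  · exact (Complex.continuous_conj.comp (continuous_expI_right x)).aestronglyMeasurable.mul
      hk.memLp.ofReal.aestronglyMeasurable
  · simp

/-- The element of `L²` that represents evaluation at `x`. -/
def evalVec (hk : IsL2Weight k) (x : Sp n) : Lp ℂ 2 (volume : Measure (Sp n)) :=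
  (memLp_conj_expI_mul_inv hk x).toLp

theorem inner_evalVec (hk : IsL2Weight k) (x : Sp n) (β : Lp ℂ 2 (volume : Measure (Sp n))) :
    inner ℂ (evalVec hk x) β = synth (fun ξ => ((1 / k ξ : ℝ) : ℂ) * β ξ) x := by
  rw [L2.inner_def]
  refine integral_congr_ae ?_
  filter_upwards [(memLp_conj_expI_mul_inv hk x).coeFn_toLp] with ξ hξ
  rw [evalVec, hξ]
  simp only [RCLike.inner_apply, map_mul, Complex.conj_conj, Complex.conj_ofReal]
  ring

theorem fourierRep_iff_featureRep (hk : IsL2Weight k) :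
    FourierRep k f M ↔ FeatureRep (evalVec hk) f M := by
  constructor
  · rintro ⟨hM₀, a, ha, hM, rfl⟩
    have hmem : MemLp (fun ξ => (k ξ : ℂ) * a ξ) 2 volume :=
      ⟨hk.aestronglyMeasurable_ofReal.mul ha, hM.trans_lt ENNReal.ofReal_lt_top⟩
    refine ⟨hmem.toLp, ?_, fun x => ?_⟩
    · rw [Lp.norm_toLp]
      exact ENNReal.toReal_le_of_le_ofReal hM₀ hM
    · rw [inner_evalVec]
      refine congrFun (synth_congr_ae ?_) x
      filter_upwards [hmem.coeFn_toLp] with ξ hξ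
      simp [hξ, hk.ofReal_ne_zero ξ]
  · intro h
    obtain ⟨β, hβ, hf⟩ := id h
    refine ⟨h.nonneg, fun ξ => ((1 / k ξ : ℝ) : ℂ) * β ξ, ?_, ?_, ?_⟩
    · exact hk.memLp.ofReal.aestronglyMeasurable.mul (Lp.aestronglyMeasurable β)
    · have : (fun ξ => (k ξ : ℂ) * (((1 / k ξ : ℝ) : ℂ) * β ξ)) = β := by
        funext ξ
        simp [hk.ofReal_ne_zero ξ]
      rw [this, ← Lp.enorm_def, ← ofReal_norm]
      exact ENNReal.ofReal_le_ofReal hβ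
    · exact funext fun x => (hf x).trans (inner_evalVec hk x β)

namespace FourierRep

theorem nonneg (h : FourierRep k f M) : 0 ≤ M := h.1

theorem mono (h : FourierRep k f M) (hMN : M ≤ N) : FourierRep k f N := by
  obtain ⟨hM₀, a, ha, hM, hf⟩ := h
  exact ⟨hM₀.trans hMN, a, ha, hM.trans (ENNReal.ofReal_le_ofReal hMN), hf⟩

theorem exists_measurable (h : FourierRep k f M) : ∃ a : Sp n → ℂ, Measurable a ∧
    eLpNorm (fun ξ => (k ξ : ℂ) * a ξ) 2 ≤ ENNReal.ofReal M ∧ f = synth a := by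
  obtain ⟨-, a, ha, hM, rfl⟩ := h
  refine ⟨ha.mk a, ha.stronglyMeasurable_mk.measurable, ?_, synth_congr_ae ha.ae_eq_mk⟩
  refine (eLpNorm_congr_ae ?_).trans_le hM
  filter_upwards [ha.ae_eq_mk] with ξ hξ
  rw [hξ]

theorem norm_le (hk : IsL2Weight k) (h : FourierRep k f M) (x : Sp n) : ‖f x‖ ≤ invNorm k * M := by
  obtain ⟨hM₀, a, ha, hM, rfl⟩ := h
  exact (norm_synth_le a x).trans (hk.integral_norm_le ha hM₀ hM)

theorem continuous (hk : IsL2Weight k) (h : FourierRep k f M) : Continuous f := by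
  obtain ⟨-, a, ha, hM, rfl⟩ := h
  exact continuous_synth (hk.integrable ha hM)

theorem zero (hk : IsL2Weight k) : FourierRep k (fun _ => 0) 0 :=
  (fourierRep_iff_featureRep hk).2 (.zero _)

theorem const_mul (hk : IsL2Weight k) (z : ℂ) (h : FourierRep k f M) :
    FourierRep k (fun x => z * f x) (‖z‖ * M) :=
  (fourierRep_iff_featureRep hk).2 (((fourierRep_iff_featureRep hk).1 h).const_mul z)

theorem add (hk : IsL2Weight k) (hf : FourierRep k f M) (hg : FourierRep k g N) :
    FourierRep k (fun x => f x + g x) (M + N) :=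
  (fourierRep_iff_featureRep hk).2
    (((fourierRep_iff_featureRep hk).1 hf).add ((fourierRep_iff_featureRep hk).1 hg))

theorem sum (hk : IsL2Weight k) {ι : Type*} (s : Finset ι) {f : ι → Sp n → ℂ} {M : ι → ℝ}
    (h : ∀ i ∈ s, FourierRep k (f i) (M i)) :
    FourierRep k (fun x => ∑ i ∈ s, f i x) (∑ i ∈ s, M i) := by
  induction s using Finset.cons_induction with
  | empty => simpa using FourierRep.zero hk
  | cons i s hi ih =>
    simp only [Finset.sum_cons]
    exact (h i (Finset.mem_cons_self i s)).add hk
      (ih fun j hj => h j (Finset.mem_cons_of_mem hj))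

theorem of_tendsto (hk : IsL2Weight k) {ι : Type*} {l : Filter ι} [l.NeBot] {F : ι → Sp n → ℂ}
    (hF : ∀ i, FourierRep k (F i) M) (hlim : ∀ x, Tendsto (fun i => F i x) l (𝓝 (f x))) :
    FourierRep k f M :=
  (fourierRep_iff_featureRep hk).2
    (.of_tendsto (fun i => (fourierRep_iff_featureRep hk).1 (hF i)) hlim)

theorem integral (hk : IsL2Weight k) {Θ : Type*} [MeasurableSpace Θ] {μ : Measure Θ}
    {F : Θ → Sp n → ℂ} {M : Θ → ℝ} (hF : ∀ θ, FourierRep k (F θ) (M θ)) (hM : Integrable M μ)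
    (hint : ∀ x, Integrable (fun θ => F θ x) μ) :
    FourierRep k (fun x => ∫ θ, F θ x ∂μ) (∫ θ, M θ ∂μ) :=
  (fourierRep_iff_featureRep hk).2
    (.integral (fun θ => (fourierRep_iff_featureRep hk).1 (hF θ)) hM hint)

end FourierRep

end FourierRep

section Algebra

theorem sq_lintegral_mul_le {α : Type*} [MeasurableSpace α] (μ : Measure α) {f g : α → ℝ≥0∞}
    (hf : AEMeasurable f μ) (hg : AEMeasurable g μ) :
    (∫⁻ x, f x * g x ∂μ) ^ 2 ≤ (∫⁻ x, f x ^ 2 ∂μ) * ∫⁻ x, g x ^ 2 ∂μ := by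
  have sq_sqrt (y : ℝ≥0∞) : (y ^ (1 / 2 : ℝ)) ^ 2 = y := by
    rw [← ENNReal.rpow_natCast, ← ENNReal.rpow_mul]; simp
  refine (pow_le_pow_left' (ENNReal.lintegral_mul_le_Lp_mul_Lq μ .two_two hf hg) 2).trans_eq ?_
  simp only [mul_pow, sq_sqrt, ENNReal.rpow_two]

theorem sq_eLpNorm_two {α E : Type*} [MeasurableSpace α] [NormedAddCommGroup E] (μ : Measure α)
    (f : α → E) : eLpNorm f 2 μ ^ 2 = ∫⁻ x, ‖f x‖ₑ ^ 2 ∂μ := by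
  simpa using eLpNorm_nnreal_pow_eq_lintegral (μ := μ) (f := f) (p := 2) two_ne_zero

theorem lintegral_lintegral_mul_sub {G : Type*} [AddGroup G] [MeasurableSpace G]
    [MeasurableAdd₂ G] [MeasurableNeg G] (μ : Measure G) [SFinite μ] [μ.IsAddRightInvariant]
    {f g : G → ℝ≥0∞} (hf : Measurable f) (hg : Measurable g) :
    ∫⁻ x, ∫⁻ y, f y * g (x - y) ∂μ ∂μ = (∫⁻ x, f x ∂μ) * ∫⁻ x, g x ∂μ := by
  rw [lintegral_lintegral_swap (by fun_prop : Measurable fun p : G × G =>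
    f p.2 * g (p.1 - p.2)).aemeasurable, ← lintegral_mul_const _ hf]
  refine lintegral_congr fun y => ?_
  rw [lintegral_const_mul _ (by fun_prop), lintegral_sub_right_eq_self g y]

/-- A weight with reciprocal in `L²` that satisfies `(1/k²) * (1/k²) ≤ C²/k²`, the requirement under
which the functions with Fourier transform in `L²(k² dξ)` form an algebra. -/
structure IsAlgebraWeight (k : Sp n → ℝ) (C : ℝ) : Prop extends IsL2Weight k where
  const_pos : 0 < C
  convolution_le : ∀ ξ, ∫⁻ η, ENNReal.ofReal (1 / k η ^ 2) * ENNReal.ofReal (1 / k (ξ - η) ^ 2) ≤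
    ENNReal.ofReal (C ^ 2 / k ξ ^ 2)

variable {k : Sp n → ℝ} {a b : Sp n → ℂ} {f g : Sp n → ℂ} {C M N : ℝ}

theorem IsL2Weight.enorm_eq (hk : IsL2Weight k) (z : ℂ) (ξ : Sp n) :
    ‖z‖ₑ = ENNReal.ofReal (1 / k ξ) * ‖(k ξ : ℂ) * z‖ₑ := by
  rw [enorm_mul, hk.enorm_ofReal, ← mul_assoc,
    ← ENNReal.ofReal_mul (one_div_nonneg.2 (hk.pos ξ).le), one_div_mul_cancel (hk.pos ξ).ne',
    ENNReal.ofReal_one, one_mul]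

namespace IsAlgebraWeight

theorem sq_enorm_mul_integral_le (hk : IsAlgebraWeight k C) (ha : Measurable a) (hb : Measurable b)
    (ξ : Sp n) : ‖(k ξ : ℂ) * ∫ η, a η * b (ξ - η)‖ₑ ^ 2 ≤ ENNReal.ofReal (C ^ 2) *
      ∫⁻ η, ‖(k η : ℂ) * a η‖ₑ ^ 2 * ‖(k (ξ - η) : ℂ) * b (ξ - η)‖ₑ ^ 2 := by
  have hk_meas := hk.measurable
  have hk_ne := (hk.pos ξ).ne'
  have sq_inv (η : Sp n) : ENNReal.ofReal (1 / k η) ^ 2 = ENNReal.ofReal (1 / k η ^ 2) := by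
    rw [← ENNReal.ofReal_pow (one_div_nonneg.2 (hk.pos η).le), one_div_pow]
  have norm_le : ‖∫ η, a η * b (ξ - η)‖ₑ ≤
      ∫⁻ η, (ENNReal.ofReal (1 / k η) * ENNReal.ofReal (1 / k (ξ - η))) *
        (‖(k η : ℂ) * a η‖ₑ * ‖(k (ξ - η) : ℂ) * b (ξ - η)‖ₑ) := by
    refine (enorm_integral_le_lintegral_enorm _).trans_eq (lintegral_congr fun η => ?_)
    rw [enorm_mul, hk.enorm_eq (a η) η, hk.enorm_eq (b (ξ - η)) (ξ - η)]
    ring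
  have sq_le := (pow_le_pow_left' norm_le 2).trans
    (sq_lintegral_mul_le _ (by fun_prop) (by fun_prop))
  simp only [mul_pow, sq_inv] at sq_le
  have const_eq : ENNReal.ofReal (k ξ) ^ 2 * ENNReal.ofReal (C ^ 2 / k ξ ^ 2) =
      ENNReal.ofReal (C ^ 2) := by
    rw [← ENNReal.ofReal_pow (hk.pos ξ).le, ← ENNReal.ofReal_mul (by positivity)]
    congr 1
    field_simp
  rw [enorm_mul, mul_pow, hk.enorm_ofReal, ← const_eq, mul_assoc]
  exact mul_le_mul_right (sq_le.trans (mul_le_mul_left (hk.convolution_le ξ) _)) _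

theorem eLpNorm_mul_integral_le (hk : IsAlgebraWeight k C) (ha : Measurable a)
    (hb : Measurable b) : eLpNorm (fun ξ => (k ξ : ℂ) * ∫ η, a η * b (ξ - η)) 2 ≤
      ENNReal.ofReal C * eLpNorm (fun ξ => (k ξ : ℂ) * a ξ) 2 *
        eLpNorm (fun ξ => (k ξ : ℂ) * b ξ) 2 := by
  have hk_meas := hk.measurable
  refine (ENNReal.pow_le_pow_left_iff two_ne_zero).1 ?_
  rw [sq_eLpNorm_two, mul_pow, mul_pow, sq_eLpNorm_two, sq_eLpNorm_two,
    ← ENNReal.ofReal_pow hk.const_pos.le, mul_assoc,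
    ← lintegral_lintegral_mul_sub volume (by fun_prop) (by fun_prop),
    ← lintegral_const_mul' _ _ ENNReal.ofReal_ne_top]
  exact lintegral_mono (hk.sq_enorm_mul_integral_le ha hb)

end IsAlgebraWeight

theorem FourierRep.mul (hk : IsAlgebraWeight k C) (hf : FourierRep k f M) (hg : FourierRep k g N) :
    FourierRep k (fun x => f x * g x) (C * M * N) := by
  have hM₀ := hf.nonneg
  obtain ⟨a, ha, hM, rfl⟩ := hf.exists_measurable
  obtain ⟨b, hb, hN, rfl⟩ := hg.exists_measurable
  have hai := hk.integrable ha.aestronglyMeasurable hM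
  have hbi := hk.integrable hb.aestronglyMeasurable hN
  refine ⟨mul_nonneg (mul_nonneg hk.const_pos.le hM₀) hg.nonneg, fun ξ => ∫ η, a η * b (ξ - η),
    ?_, ?_, funext (synth_mul_synth hai hbi)⟩
  · exact (hai.integrable_convolution (ContinuousLinearMap.mul ℂ ℂ) hbi).aestronglyMeasurable
  · rw [ENNReal.ofReal_mul (mul_nonneg hk.const_pos.le hM₀), ENNReal.ofReal_mul hk.const_pos.le]
    exact (hk.eLpNorm_mul_integral_le ha hb).trans (by gcongr)

end Algebra

section PolynomialWeights

theorem one_le_bracket (ξ : Sp n) : 1 ≤ bracket ξ :=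
  Real.one_le_sqrt.2 (le_add_of_nonneg_right (sq_nonneg _))

theorem bracket_rpow_nonneg (ξ : Sp n) (N : ℝ) : 0 ≤ bracket ξ ^ N :=
  Real.rpow_nonneg (Real.sqrt_nonneg _) N

theorem bracket_le (ξ : Sp n) : bracket ξ ≤ 1 + ‖ξ‖ :=
  Real.sqrt_le_iff.2 ⟨by positivity, by nlinarith [norm_nonneg ξ]⟩

theorem hasTemperateGrowth_bracket_rpow (N : ℝ) :
    Function.HasTemperateGrowth fun ξ : Sp n => bracket ξ ^ N := by
  have bracket_rpow (ξ : Sp n) : bracket ξ ^ N = (1 + ‖ξ‖ ^ 2) ^ (N / 2) := by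
    rw [bracket, Real.sqrt_eq_rpow, ← Real.rpow_mul (by positivity)]
    ring_nf
  simp only [bracket_rpow]
  fun_prop

theorem integrable_bracket_rpow_mul (φ : 𝓢(Sp n, ℂ)) (N : ℝ) :
    Integrable fun ξ => bracket ξ ^ N * ‖φ ξ‖ := by
  refine (SchwartzMap.smulLeftCLM ℂ (fun ξ : Sp n => bracket ξ ^ N) φ).integrable.norm.congr
    (Eventually.of_forall fun ξ => ?_)
  simp only [SchwartzMap.smulLeftCLM_apply_apply (hasTemperateGrowth_bracket_rpow N), norm_smul,
    Real.norm_of_nonneg (bracket_rpow_nonneg ξ N)]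

end PolynomialWeights

section Translations

variable {k : Sp n → ℝ} {f : Sp n → ℂ} {M : ℝ}

namespace FourierRep

theorem comp_add_right (hf : FourierRep k f M) (y : Sp n) :
    FourierRep k (fun x => f (x + y)) M := by
  obtain ⟨hM₀, a, ha, hM, rfl⟩ := hf
  refine ⟨hM₀, fun ξ => expI y ξ * a ξ,
    (continuous_expI_right y).aestronglyMeasurable.mul ha, ?_, ?_⟩
  · refine (eLpNorm_congr_norm_ae (Eventually.of_forall fun ξ => ?_)).trans_le hM
    simp only [norm_mul, norm_expI, one_mul]
  · funext x
    simp only [synth, expI_add_left, mul_assoc]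

theorem expI_mul (hk : IsL2Weight k) {D : ℝ} (hD : 0 ≤ D) {η : Sp n}
    (hle : ∀ ξ, k (η + ξ) ≤ D * k ξ) (hf : FourierRep k f M) :
    FourierRep k (fun x => expI x η * f x) (D * M) := by
  obtain ⟨hM₀, a, ha, hM, rfl⟩ := hf
  have sub_η : MeasurePreserving (fun ξ : Sp n => ξ - η) := measurePreserving_sub_right volume η
  refine ⟨mul_nonneg hD hM₀, fun ξ => a (ξ - η), ha.comp_measurePreserving sub_η, ?_,
    funext fun x => expI_mul_synth a x η⟩
  have comp_sub := eLpNorm_comp_measurePreserving (p := 2)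
    (hk.aestronglyMeasurable_ofReal.mul ha) sub_η
  rw [ENNReal.ofReal_mul hD]
  refine le_trans ?_ (mul_le_mul_right (comp_sub.trans_le hM) _)
  refine eLpNorm_le_mul_eLpNorm_of_ae_le_mul (Eventually.of_forall fun ξ => ?_) 2
  simp only [Function.comp_apply, Pi.mul_apply, norm_mul, Complex.norm_real,
    Real.norm_of_nonneg (hk.pos _).le, ← mul_assoc]
  refine mul_le_mul_of_nonneg_right ?_ (norm_nonneg _)
  simpa using hle (ξ - η)

/-- `synth b (x - y)` is a superposition of the characters `x ↦ e^{i⟨x,η⟩}`, and the translation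
by `y` only multiplies their coefficients by numbers of modulus one. -/
theorem synth_mul (hk : IsL2Weight k) {C N : ℝ} (hC : 0 ≤ C)
    (hle : ∀ ξ η, k (ξ + η) ≤ C * bracket ξ ^ N * k η) {b : Sp n → ℂ} (hb : Integrable b)
    (hbN : Integrable fun ξ => bracket ξ ^ N * ‖b ξ‖) (hf : FourierRep k f M) (y : Sp n) :
    FourierRep k (fun x => synth b (x - y) * f x) (C * (∫ ξ, bracket ξ ^ N * ‖b ξ‖) * M) := by
  have character_mul (η : Sp n) : FourierRep k (fun x => (expI (-y) η * b η) * (expI x η * f x))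
      (‖expI (-y) η * b η‖ * (C * bracket η ^ N * M)) :=
    (hf.expI_mul hk (mul_nonneg hC (bracket_rpow_nonneg η N)) (hle η)).const_mul hk _
  have integrand_eq (x : Sp n) : (fun η => (expI (-y) η * b η) * (expI x η * f x)) =
      fun η => expI (x - y) η * b η * f x := by
    funext η
    rw [sub_eq_add_neg, expI_add_left]
    ring
  have bound_eq : (fun η => ‖expI (-y) η * b η‖ * (C * bracket η ^ N * M)) =
      fun η => C * (bracket η ^ N * ‖b η‖) * M := by
    funext η
    rw [norm_mul, norm_expI]
    ring
  have superposition := FourierRep.integral hk character_mul (μ := volume)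
    (by simpa only [bound_eq] using (hbN.const_mul C).mul_const M)
    (fun x => by simpa only [integrand_eq] using (integrable_expI_mul hb (x - y)).mul_const (f x))
  simpa only [bound_eq, integrand_eq, integral_mul_const, integral_const_mul, synth]
    using superposition

end FourierRep

end Translations

section Inversion

theorem schwartz_eq_synth (φ : 𝓢(Sp n, ℂ)) :
    (φ : Sp n → ℂ) = synth fun ξ => ((2 * Real.pi : ℝ) ^ n : ℂ)⁻¹ * fourierS φ ξ := by
  have two_pi_pos : 0 < 2 * Real.pi := Real.two_pi_pos
  have fourierS_two_pi_smul (η : Sp n) : fourierS φ ((2 * Real.pi) • η) = 𝓕 φ η := by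
    change 𝓕 φ ((2 * Real.pi)⁻¹ • (2 * Real.pi) • η) = _
    rw [inv_smul_smul₀ two_pi_pos.ne']
  funext x
  have inversion : φ x = ∫ η, expI x ((2 * Real.pi) • η) * fourierS φ ((2 * Real.pi) • η) := by
    rw [← congrFun (congrArg DFunLike.coe
        (FourierTransform.fourierInv_fourier_eq (F := 𝓢(Sp n, ℂ)) φ)) x,
      SchwartzMap.fourierInv_coe, Real.fourierInv_eq']
    refine integral_congr_ae (Eventually.of_forall fun η => ?_)
    simp only [fourierS_two_pi_smul, expI, inner_smul_right, real_inner_comm, smul_eq_mul,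
      mul_comm Complex.I]
  rw [inversion, Measure.integral_comp_smul_of_nonneg volume
    (fun ξ => expI x ξ * fourierS φ ξ) _ (hR := two_pi_pos.le),
    finrank_euclideanSpace_fin, synth, Complex.real_smul, ← integral_const_mul]
  refine integral_congr_ae (Eventually.of_forall fun ξ => ?_)
  simp only
  push_cast
  ring

variable {k : Sp n → ℝ}

theorem exists_fourierRep_schwartz_mul (hk : IsL2Weight k) (hpol : IsKpol k) (φ : 𝓢(Sp n, ℂ)) :
    ∃ C : ℝ, 0 ≤ C ∧ ∀ (f : Sp n → ℂ) (M : ℝ), FourierRep k f M → ∀ y,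
      FourierRep k (fun x => φ (x - y) * f x) (C * M) := by
  obtain ⟨-, -, C, N, hC, -, hle⟩ := hpol
  let b : 𝓢(Sp n, ℂ) := ((2 * Real.pi : ℝ) ^ n : ℂ)⁻¹ • fourierS φ
  have hφ : synth b = φ := (schwartz_eq_synth φ).symm
  refine ⟨C * ∫ ξ, bracket ξ ^ N * ‖b ξ‖, mul_nonneg hC.le (integral_nonneg fun ξ =>
    mul_nonneg (bracket_rpow_nonneg ξ N) (norm_nonneg _)), fun f M hf y => ?_⟩
  rw [← hφ]
  exact hf.synth_mul hk hC.le hle b.integrable (integrable_bracket_rpow_mul b N) y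

/-- The weighted Fourier transform `φ ↦ ⟨ξ⟩^N φ̂`, with values in `L²`. -/
def weightedFourier (N : ℝ) : 𝓢(Sp n, ℂ) →L[ℝ] Lp ℂ 2 (volume : Measure (Sp n)) :=
  SchwartzMap.toLpCLM ℝ ℂ 2 volume ∘L SchwartzMap.smulLeftCLM ℂ (fun ξ : Sp n => bracket ξ ^ N) ∘L
    SchwartzMap.compCLMOfContinuousLinearEquiv ℝ (dilation n) ∘L
      FourierTransform.fourierCLM ℝ 𝓢(Sp n, ℂ)

theorem ofReal_norm_weightedFourier (N : ℝ) (φ : 𝓢(Sp n, ℂ)) :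
    ENNReal.ofReal ‖weightedFourier N φ‖ =
      eLpNorm (fun ξ => bracket ξ ^ N • fourierS φ ξ) 2 := by
  have weightedFourier_eq : weightedFourier N φ =
      (SchwartzMap.smulLeftCLM ℂ (fun ξ : Sp n => bracket ξ ^ N) (fourierS φ)).toLp 2 volume := rfl
  rw [weightedFourier_eq, SchwartzMap.norm_toLp,
    ENNReal.ofReal_toReal (SchwartzMap.memLp _ 2 volume).eLpNorm_ne_top,
    SchwartzMap.smulLeftCLM_apply (hasTemperateGrowth_bracket_rpow N)]

theorem exists_continuous_seminorm_fourierRep (hk : IsKpol k) :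
    ∃ p : Seminorm ℝ 𝓢(Sp n, ℂ), Continuous p ∧ ∀ φ : 𝓢(Sp n, ℂ), FourierRep k φ (p φ) := by
  obtain ⟨-, hk_pos, C, N, hC, -, hle⟩ := hk
  let c : ℝ := C * k 0 * ((2 * Real.pi) ^ n)⁻¹
  have hk₀ := hk_pos 0
  have hc : 0 ≤ c := by positivity
  refine ⟨(normSeminorm ℝ (Lp ℂ 2 volume)).comp (c • weightedFourier N).toLinearMap,
    (c • weightedFourier N).continuous.norm, fun φ => ?_⟩
  change FourierRep k φ ‖c • weightedFourier N φ‖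
  rw [norm_smul, Real.norm_of_nonneg hc]
  refine ⟨by positivity, _, (continuous_const.mul (fourierS φ).continuous).aestronglyMeasurable, ?_,
    schwartz_eq_synth φ⟩
  rw [ENNReal.ofReal_mul hc, ofReal_norm_weightedFourier]
  refine eLpNorm_le_mul_eLpNorm_of_ae_le_mul (Eventually.of_forall fun ξ => ?_) 2
  have k_le : k ξ ≤ C * bracket ξ ^ N * k 0 := by simpa using hle ξ 0
  calc ‖(k ξ : ℂ) * (((2 * Real.pi : ℝ) ^ n : ℂ)⁻¹ * fourierS φ ξ)‖
      = k ξ * (((2 * Real.pi) ^ n)⁻¹ * ‖fourierS φ ξ‖) := by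
        simp [abs_of_pos (hk_pos ξ), abs_of_pos Real.pi_pos]
    _ ≤ C * bracket ξ ^ N * k 0 * (((2 * Real.pi) ^ n)⁻¹ * ‖fourierS φ ξ‖) := by gcongr
    _ = c * ‖bracket ξ ^ N • fourierS φ ξ‖ := by
        rw [norm_smul, Real.norm_of_nonneg (bracket_rpow_nonneg ξ N)]
        ring

end Inversion

section SmoothFunctions

/-- A test function, regarded as a Schwartz function. -/
def Test.toSchwartz (φ : Test n) : 𝓢(Sp n, ℂ) := φ.hasCompactSupport.toSchwartzMap φ.contDiff

@[simp] theorem Test.toSchwartz_apply (φ : Test n) (x : Sp n) : φ.toSchwartz x = φ x := rfl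

theorem schwartzSeminorm_le_of_eq_mul {χ φ : 𝓢(Sp n, ℂ)} {g : Sp n → ℂ} (hg : ContDiff ℝ ∞ g)
    (hφ : (φ : Sp n → ℂ) = fun x => χ x * g x) {B : ℝ} {b : ℕ}
    (hB : ∀ i ≤ b, ∀ x, ‖iteratedFDeriv ℝ i g x‖ ≤ B) (a : ℕ) :
    SchwartzMap.seminorm ℝ a b φ ≤
      (∑ i ∈ Finset.range (b + 1), b.choose i * SchwartzMap.seminorm ℝ a i χ) * B := by
  have hB₀ : 0 ≤ B := (norm_nonneg _).trans (hB 0 b.zero_le 0)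
  refine SchwartzMap.seminorm_le_bound ℝ a b φ (by positivity) fun x => ?_
  calc ‖x‖ ^ a * ‖iteratedFDeriv ℝ b φ x‖
      ≤ ‖x‖ ^ a * ∑ i ∈ Finset.range (b + 1),
          (b.choose i : ℝ) * ‖iteratedFDeriv ℝ i χ x‖ * ‖iteratedFDeriv ℝ (b - i) g x‖ := by
        rw [hφ]
        gcongr
        exact norm_iteratedFDeriv_mul_le (χ.smooth ⊤) hg x (by exact_mod_cast le_top)
    _ = ∑ i ∈ Finset.range (b + 1), b.choose i * (‖x‖ ^ a * ‖iteratedFDeriv ℝ i χ x‖) *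
          ‖iteratedFDeriv ℝ (b - i) g x‖ := by
        rw [Finset.mul_sum]
        exact Finset.sum_congr rfl fun i _ => by ring
    _ ≤ ∑ i ∈ Finset.range (b + 1), b.choose i * SchwartzMap.seminorm ℝ a i χ * B := by
        gcongr with i
        · exact χ.le_seminorm ℝ a i x
        · exact hB _ (b.sub_le i) x
    _ = _ := (Finset.sum_mul ..).symm

variable {k : Sp n → ℝ}

theorem exists_fourierRep_test_mul (hk : IsKpol k) (χ : Test n) :
    ∃ (m : ℕ) (C : ℝ), 0 ≤ C ∧ ∀ (g : Sp n → ℂ) (B : ℝ), ContDiff ℝ ∞ g →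
      (∀ i ≤ m, ∀ x, ‖iteratedFDeriv ℝ i g x‖ ≤ B) → ∀ y,
        FourierRep k (fun x => χ (x - y) * g x) (C * B) := by
  obtain ⟨p, hp, hpk⟩ := exists_continuous_seminorm_fourierRep hk
  obtain ⟨s, C, -, hpC⟩ := Seminorm.bound_of_continuous
    (schwartz_withSeminorms ℝ (Sp n) ℂ) p hp
  let W (q : ℕ × ℕ) : ℝ := ∑ i ∈ Finset.range (q.2 + 1),
    q.2.choose i * SchwartzMap.seminorm ℝ q.1 i χ.toSchwartz
  have hW (q) : 0 ≤ W q := by positivity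
  refine ⟨s.sup Prod.snd, C * ∑ q ∈ s, W q,
    mul_nonneg C.2 (Finset.sum_nonneg fun q _ => hW q), fun g B hg hB y => ?_⟩
  have hB₀ : 0 ≤ B := (norm_nonneg _).trans (hB 0 (Nat.zero_le _) 0)
  have hg_y : ContDiff ℝ ∞ fun x => g (x + y) := hg.comp (contDiff_id.add contDiff_const)
  let φ : 𝓢(Sp n, ℂ) :=
    (χ.hasCompactSupport.mul_right (f' := fun x => g (x + y))).toSchwartzMap (χ.contDiff.mul hg_y)
  have hφ : (φ : Sp n → ℂ) = fun x => χ.toSchwartz x * g (x + y) := rfl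
  have hpφ : p φ ≤ C * (∑ q ∈ s, W q) * B := by
    refine (hpC φ).trans ?_
    rw [_root_.smul_apply, NNReal.smul_def, smul_eq_mul, mul_assoc]
    refine mul_le_mul_of_nonneg_left (Seminorm.finset_sup_apply_le
      (mul_nonneg (Finset.sum_nonneg fun q _ => hW q) hB₀) fun q hq => ?_) C.2
    refine (schwartzSeminorm_le_of_eq_mul hg_y hφ (fun i hi x => ?_) q.1).trans
      (mul_le_mul_of_nonneg_right (Finset.single_le_sum (fun q _ => hW q) hq) hB₀)
    rw [iteratedFDeriv_comp_add_right]
    exact hB i (hi.trans (Finset.le_sup (f := Prod.snd) hq)) _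
  simpa [φ, sub_eq_add_neg] using ((hpk φ).mono hpφ).comp_add_right (-y)

variable {E : Type*} [NormedAddCommGroup E] [NormedSpace ℝ E]

theorem norm_iteratedFDeriv_schwartz_comp_add_le (G : 𝓢(E, ℂ)) {v : Sp n → E}
    (hv : ContDiff ℝ ∞ v) {D : ℝ} (hD : 1 ≤ D) {m : ℕ}
    (hvD : ∀ i, 1 ≤ i → i ≤ m → ∀ x, ‖iteratedFDeriv ℝ i v x‖ ≤ D ^ i) (c : E)
    {i : ℕ} (hi : i ≤ m) (x : Sp n) :
    ‖iteratedFDeriv ℝ i (fun x => G (v x + c)) x‖ ≤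
      m.factorial * (Finset.Iic (0, m)).sup (schwartzSeminormFamily ℝ E ℂ) G * D ^ m := by
  have hG (l : ℕ) (hl : l ≤ m) (z : E) : ‖iteratedFDeriv ℝ l G z‖ ≤
      (Finset.Iic (0, m)).sup (schwartzSeminormFamily ℝ E ℂ) G := by
    have weighted_le : (1 + ‖z‖) ^ 0 * ‖iteratedFDeriv ℝ l G z‖ ≤
        2 ^ 0 * (Finset.Iic (0, m)).sup (schwartzSeminormFamily ℝ E ℂ) G :=
      SchwartzMap.one_add_le_sup_seminorm_apply (m := (0, m)) le_rfl hl G z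
    simpa only [pow_zero, one_mul] using weighted_le
  have hG_c : ContDiff ℝ ∞ fun z => G (z + c) :=
    (G.smooth ⊤).comp (contDiff_id.add contDiff_const)
  refine (norm_iteratedFDeriv_comp_le hG_c hv (n := i) (by exact_mod_cast le_top) x
    (C := (Finset.Iic (0, m)).sup (schwartzSeminormFamily ℝ E ℂ) G) (fun l hl => ?_)
    fun l h1 hl => hvD l h1 (hl.trans hi) x).trans ?_
  · rw [iteratedFDeriv_comp_add_right]
    exact hG l (hl.trans hi) _
  · gcongr

theorem exists_fourierRep_test_mul_comp (hk : IsKpol k) (χ : Test n) (G : 𝓢(E, ℂ)) {D : ℝ}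
    (hD : 1 ≤ D) :
    ∃ (m : ℕ) (M : ℝ), 0 ≤ M ∧ ∀ v : Sp n → E, ContDiff ℝ ∞ v →
      (∀ i, 1 ≤ i → i ≤ m → ∀ x, ‖iteratedFDeriv ℝ i v x‖ ≤ D ^ i) → ∀ (c : E) (y : Sp n),
        FourierRep k (fun x => χ (x - y) * G (v x + c)) M := by
  obtain ⟨m, C, hC, hrep⟩ := exists_fourierRep_test_mul hk χ
  refine ⟨m, C * (m.factorial * (Finset.Iic (0, m)).sup (schwartzSeminormFamily ℝ E ℂ) G * D ^ m),
    by positivity, fun v hv hvD c y => hrep _ _ ?_ (fun i hi x =>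
      norm_iteratedFDeriv_schwartz_comp_add_le G hv hD hvD c hi x) y⟩
  exact (G.smooth ⊤).comp (hv.add contDiff_const)

end SmoothFunctions

section WeightedDistributions

theorem integral_synth_mul {a b : Sp n → ℂ} (ha : Integrable a) (hb : Integrable b) :
    ∫ x, synth a x * b x = ∫ ξ, a ξ * synth b ξ := by
  have integrable_prod : Integrable (fun p : Sp n × Sp n => expI p.1 p.2 * (b p.1 * a p.2))
      (volume.prod volume) :=
    (hb.mul_prod ha).bdd_mul (c := 1) continuous_expI.aestronglyMeasurable
      (Eventually.of_forall fun p => (norm_expI p.1 p.2).le)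
  calc ∫ x, synth a x * b x = ∫ x, ∫ ξ, expI x ξ * (b x * a ξ) := by
        simp only [synth, ← integral_mul_const, mul_assoc, mul_comm (a _)]
    _ = ∫ ξ, ∫ x, expI x ξ * (b x * a ξ) := integral_integral_swap integrable_prod
    _ = ∫ ξ, a ξ * synth b ξ := by
        simp only [synth, ← mul_assoc, integral_mul_const, mul_comm (a _)]
        simp only [expI_comm]

theorem fourierS_surjective : Function.Surjective (fourierS (n := n)) := by
  intro ψ
  refine ⟨𝓕⁻ (SchwartzMap.compCLMOfContinuousLinearEquiv ℂ (dilation n).symm ψ), ?_⟩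
  rw [fourierS, FourierTransform.fourier_fourierInv_eq]
  ext x
  simp only [SchwartzMap.compCLMOfContinuousLinearEquiv_apply, Function.comp_apply,
    ContinuousLinearEquiv.symm_apply_apply]

theorem two_pi_pow_ne_zero (n : ℕ) : ((2 * Real.pi : ℝ) ^ n : ℂ) ≠ 0 :=
  pow_ne_zero n (Complex.ofReal_ne_zero.2 Real.two_pi_pos.ne')

theorem norm_two_pi_pow (n : ℕ) : ‖((2 * Real.pi : ℝ) ^ n : ℂ)‖ = (2 * Real.pi) ^ n := by
  rw [norm_pow, Complex.norm_of_nonneg Real.two_pi_pos.le]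

theorem synth_fourierS (φ : 𝓢(Sp n, ℂ)) (x : Sp n) :
    synth (fourierS φ) x = ((2 * Real.pi : ℝ) ^ n : ℂ) * φ x := by
  conv_rhs => rw [schwartz_eq_synth φ]
  simp only [synth, mul_left_comm (expI _ _), integral_const_mul,
    mul_inv_cancel_left₀ (two_pi_pow_ne_zero n)]

variable {k : Sp n → ℝ} {T : 𝓢'(Sp n, ℂ)} {M : ℝ}

theorem exists_fourierRep_of_bNorm_lt (hk : IsL2Weight k) (hM : 0 ≤ M)
    (hT : bNorm k T < ENNReal.ofReal M) :
    ∃ F : Sp n → ℂ, FourierRep k F (((2 * Real.pi) ^ n)⁻¹ * M) ∧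
      ∀ ψ : 𝓢(Sp n, ℂ), T ψ = ∫ x, F x * ψ x := by
  simp only [bNorm, iInf_lt_iff] at hT
  obtain ⟨g, hg, hgM⟩ := hT
  have hrep : FourierRep k (synth g) M := ⟨hM, g, hg.1, hgM.le, rfl⟩
  refine ⟨fun x => ((2 * Real.pi : ℝ) ^ n : ℂ)⁻¹ * synth g x, ?_, fun ψ => ?_⟩
  · simpa only [norm_inv, norm_two_pi_pow]
      using hrep.const_mul hk ((2 * Real.pi : ℝ) ^ n : ℂ)⁻¹
  obtain ⟨φ, rfl⟩ := fourierS_surjective ψ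
  simp only [mul_assoc, (hg.2 φ).2, integral_const_mul, synth_fourierS,
    integral_synth_mul (hk.integrable hg.1 hgM.le) (fourierS φ).integrable,
    mul_left_comm (g _), inv_mul_cancel_left₀ (two_pi_pow_ne_zero n)]

theorem bNorm_le_of_fourierRep (hk : IsL2Weight k) {F : Sp n → ℂ} (hF : FourierRep k F M)
    (hT : ∀ ψ : 𝓢(Sp n, ℂ), T ψ = ∫ x, F x * ψ x) :
    bNorm k T ≤ ENNReal.ofReal ((2 * Real.pi) ^ n * M) := by
  obtain ⟨-, a, ha, hM, rfl⟩ := hF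
  have integrable_a := hk.integrable ha hM
  let c : ℂ := ((2 * Real.pi : ℝ) ^ n : ℂ)
  have hasFourier : HasFourier T fun ξ => c * a ξ := by
    refine ⟨ha.const_mul c, fun φ => ⟨?_, ?_⟩⟩
    · exact (integrable_a.const_mul c).mul_bdd (c := ‖φ.toBoundedContinuousFunction‖)
        φ.continuous.aestronglyMeasurable
        (Eventually.of_forall fun ξ => φ.toBoundedContinuousFunction.norm_coe_le_norm ξ)
    · rw [hT, integral_synth_mul integrable_a (fourierS φ).integrable]
      simp only [synth_fourierS, c, mul_assoc, mul_left_comm (a _)]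
  have weighted_eq : (fun ξ => (k ξ : ℂ) * (c * a ξ)) = c • fun ξ => (k ξ : ℂ) * a ξ :=
    funext fun ξ => mul_left_comm _ _ _
  have enorm_c : ‖c‖ₑ = ENNReal.ofReal ((2 * Real.pi) ^ n) := by
    rw [← ofReal_norm, norm_two_pi_pow]
  refine (iInf₂_le _ hasFourier).trans ?_
  rw [weighted_eq, eLpNorm_const_smul, enorm_c, ENNReal.ofReal_mul (by positivity)]
  exact mul_le_mul_right hM _

end WeightedDistributions

section ContinuousFunctions

variable {f g : Sp n → ℂ}

theorem ofFun_apply (hf : Continuous f) (φ : Test n) : ofFun f φ = ∫ x, φ x * f x :=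
  TestFunction.integralAgainstBilinCLM_eq_integral (hf.locallyIntegrable.locallyIntegrableOn _)

theorem cutoff_ofFun_apply (hf : Continuous f) (χ : Test n) (ψ : 𝓢(Sp n, ℂ)) :
    cutoff χ (ofFun f) ψ = ∫ x, (χ x * f x) * ψ x := by
  simp only [cutoff_apply, ofFun_apply hf, mulTest_apply, mul_right_comm]

theorem integrable_test_mul (hf : Continuous f) (φ : Test n) : Integrable fun x => φ x * f x :=
  (φ.continuous.mul hf).integrable_of_hasCompactSupport φ.hasCompactSupport.mul_right

theorem ofFun_sub (hf : Continuous f) (hg : Continuous g) :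
    ofFun f - ofFun g = ofFun fun x => f x - g x := by
  ext φ
  change ofFun f φ - ofFun g φ = _
  rw [ofFun_apply hf, ofFun_apply hg, ofFun_apply (f := fun x => f x - g x) (hf.sub hg),
    ← integral_sub (integrable_test_mul hf φ) (integrable_test_mul hg φ)]
  simp only [mul_sub]

theorem eq_of_forall_integral_test (hf : Continuous f) (hg : Continuous g)
    (h : ∀ φ : Test n, ∫ x, φ x * f x = ∫ x, φ x * g x) : f = g := by
  refine (Continuous.ae_eq_iff_eq volume hf hg).1 (ae_eq_of_integral_contDiff_smul_eq
    hf.locallyIntegrable hg.locallyIntegrable fun φ hφ hφc => ?_)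
  let φ' : Test n :=
    { toFun := fun x => (φ x : ℂ)
      contDiff' := Complex.ofRealCLM.contDiff.comp hφ
      hasCompactSupport' := hφc.comp_left Complex.ofReal_zero
      tsupport_subset' := fun _ _ => trivial }
  simp only [Complex.real_smul]
  exact h φ'

theorem eq_of_ofFun_eq (hf : Continuous f) (hg : Continuous g)
    (h : ofFun f = ofFun g) : f = g :=
  eq_of_forall_integral_test hf hg fun φ => by rw [← ofFun_apply hf, ← ofFun_apply hg, h]

end ContinuousFunctions

section Windows

theorem translate_apply (y : Sp n) (χ : Test n) (x : Sp n) : translate y χ x = χ (x - y) := rfl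

theorem continuous_test_sub (χ : Test n) (y : Sp n) : Continuous fun x => χ (x - y) :=
  (translate y χ).continuous

/-- The function `f` lies in `ℬ_k^∞`, with bound `M` for the windows `χ(· - y)`; it is the notion
`FourierRep`, made local uniformly in the position. -/
def WindowRep (k : Sp n → ℝ) (χ : Test n) (f : Sp n → ℂ) (M : ℝ) : Prop :=
  ∀ y, FourierRep k (fun x => χ (x - y) * f x) M

variable {k : Sp n → ℝ} {f : Sp n → ℂ} {χ : Test n} {M : ℝ}

theorem windowRep_of_ulNorm_lt (hk : IsL2Weight k) (hf : Continuous f) (hM : 0 ≤ M)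
    (h : ulNorm k χ (ofFun f) < ENNReal.ofReal M) :
    WindowRep k χ f (((2 * Real.pi) ^ n)⁻¹ * M) := by
  intro y
  obtain ⟨F, hF, hFψ⟩ := exists_fourierRep_of_bNorm_lt hk hM ((le_iSup _ y).trans_lt h)
  have F_eq : F = fun x => χ (x - y) * f x := by
    refine eq_of_forall_integral_test (hF.continuous hk) ((continuous_test_sub χ y).mul hf)
      fun φ => ?_
    simpa only [cutoff_ofFun_apply hf, translate_apply, Test.toSchwartz_apply, mul_comm (φ _)]
      using (hFψ φ.toSchwartz).symm
  rwa [F_eq] at hF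

theorem WindowRep.ulNorm_le (hk : IsL2Weight k) (hf : Continuous f) (h : WindowRep k χ f M) :
    ulNorm k χ (ofFun f) ≤ ENNReal.ofReal ((2 * Real.pi) ^ n * M) :=
  iSup_le fun y => bNorm_le_of_fourierRep hk (h y) (cutoff_ofFun_apply hf (translate y χ))

theorem exists_test_apply_ne_zero (hχ : χ ≠ 0) : ∃ x₀, χ x₀ ≠ 0 := by
  by_contra! h
  exact hχ (TestFunction.ext h)

theorem exists_test_eq_mul_of_contDiff {φ : Test n} {h : Sp n → ℂ}
    (hh : ∀ x ∈ tsupport φ, ContDiffAt ℝ ∞ h x) : ∃ ψ : Test n, ∀ x, ψ x = φ x * h x := by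
  have smooth : ContDiff ℝ ∞ fun x => φ x * h x := by
    refine contDiff_iff_contDiffAt.2 fun x => ?_
    by_cases hx : x ∈ tsupport φ
    · exact φ.contDiff.contDiffAt.mul (hh x hx)
    · refine contDiffAt_const (c := (0 : ℂ)) |>.congr_of_eventuallyEq ?_
      filter_upwards [(isClosed_tsupport φ).isOpen_compl.mem_nhds hx] with z hz
      rw [image_eq_zero_of_notMem_tsupport hz, zero_mul]
  exact ⟨⟨_, smooth, φ.hasCompactSupport.mul_right, fun _ _ => trivial⟩, fun _ => rfl⟩

theorem exists_finset_translate_ne_zero (hχ : χ ≠ 0) {K : Set (Sp n)} (hK : IsCompact K) :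
    ∃ s : Finset (Sp n), ∀ x ∈ K, ∃ y ∈ s, χ (x - y) ≠ 0 := by
  obtain ⟨x₀, hx₀⟩ := exists_test_apply_ne_zero hχ
  obtain ⟨s, hs⟩ := hK.elim_finite_subcover (fun y => {x : Sp n | χ (x - y) ≠ 0})
    (fun y => isOpen_ne_fun (continuous_test_sub χ y) continuous_const)
    (fun x _ => Set.mem_iUnion.2 ⟨x - x₀, by simpa using hx₀⟩)
  exact ⟨s, fun x hx => by simpa using hs hx⟩

theorem exists_eq_sum_translate_mul (hχ : χ ≠ 0) (φ : Test n) :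
    ∃ (s : Finset (Sp n)) (ψ : Sp n → Test n), ∀ x, φ x = ∑ y ∈ s, χ (x - y) * ψ y x := by
  obtain ⟨s, hs⟩ := exists_finset_translate_ne_zero hχ φ.hasCompactSupport.isCompact
  let S (x : Sp n) : ℂ := ∑ y ∈ s, χ (x - y) * starRingEnd ℂ (χ (x - y))
  have χ_smooth (y) : ContDiff ℝ ∞ fun x => χ (x - y) := (translate y χ).contDiff
  have conj_smooth (y) : ContDiff ℝ ∞ fun x => starRingEnd ℂ (χ (x - y)) :=
    (Complex.conjCLE : ℂ →L[ℝ] ℂ).contDiff.comp (χ_smooth y)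
  have S_smooth : ContDiff ℝ ∞ S := ContDiff.sum fun y _ => (χ_smooth y).mul (conj_smooth y)
  have S_ne_zero (x) (hx : x ∈ tsupport φ) : S x ≠ 0 := by
    obtain ⟨y, hy, hxy⟩ := hs x hx
    simp only [S, Complex.mul_conj, ← Complex.ofReal_sum]
    have normSq_sum_pos : 0 < ∑ z ∈ s, Complex.normSq (χ (x - z)) :=
      Finset.sum_pos' (fun z _ => Complex.normSq_nonneg _) ⟨y, hy, Complex.normSq_pos.2 hxy⟩
    exact Complex.ofReal_ne_zero.2 normSq_sum_pos.ne'
  choose ψ hψ using fun y => exists_test_eq_mul_of_contDiff (φ := φ)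
    (h := fun x => starRingEnd ℂ (χ (x - y)) * (S x)⁻¹)
    fun x hx => (conj_smooth y).contDiffAt.mul (S_smooth.contDiffAt.inv (S_ne_zero x hx))
  refine ⟨s, ψ, fun x => ?_⟩
  have sum_eq : ∑ y ∈ s, χ (x - y) * ψ y x = φ x * (S x * (S x)⁻¹) := by
    simp only [hψ, S, Finset.sum_mul, Finset.mul_sum]
    exact Finset.sum_congr rfl fun y _ => by ring
  rw [sum_eq]
  by_cases hx : x ∈ tsupport φ
  · rw [mul_inv_cancel₀ (S_ne_zero x hx), mul_one]
  · rw [image_eq_zero_of_notMem_tsupport hx, zero_mul]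

theorem exists_windowRep_of_windowRep (hk : IsL2Weight k) (hpol : IsKpol k) (hχ : χ ≠ 0)
    (χ' : Test n) :
    ∃ C : ℝ, 0 ≤ C ∧ ∀ f M, WindowRep k χ f M → WindowRep k χ' f (C * M) := by
  obtain ⟨s, ψ, hψ⟩ := exists_eq_sum_translate_mul hχ χ'
  choose C hC hCψ using fun y => exists_fourierRep_schwartz_mul hk hpol (ψ y).toSchwartz
  refine ⟨∑ y ∈ s, C y, Finset.sum_nonneg fun y _ => hC y, fun f M hf y => ?_⟩
  have sum_rep := FourierRep.sum hk s (f := fun z x => ψ z (x - y) * (χ (x - (y + z)) * f x))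
    (M := fun z => C z * M) fun z _ => hCψ z _ M (hf (y + z)) y
  rw [← Finset.sum_mul] at sum_rep
  convert sum_rep using 1
  funext x
  rw [hψ, Finset.sum_mul]
  exact Finset.sum_congr rfl fun z _ => by rw [sub_sub]; ring

end Windows

section Gluing

variable {χ : Test n}

theorem distr_ext_of_cutoff_translate (hχ : χ ≠ 0) {u v : Distr n}
    (h : ∀ y, cutoff (translate y χ) u = cutoff (translate y χ) v) : u = v := by
  ext φ
  obtain ⟨s, ψ, hψ⟩ := exists_eq_sum_translate_mul hχ φ
  have φ_eq : φ = ∑ y ∈ s, mulTest (translate y χ) (ψ y).toSchwartz := by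
    have apply_sum (x : Sp n) : (∑ y ∈ s, mulTest (translate y χ) (ψ y).toSchwartz) x =
        ∑ y ∈ s, mulTest (translate y χ) (ψ y).toSchwartz x := by
      induction s using Finset.cons_induction with
      | empty => simp
      | cons => simp_all
    exact TestFunction.ext fun x => (hψ x).trans (apply_sum x).symm
  simp only [φ_eq, map_sum, ← cutoff_apply, h]

theorem mul_comm_of_cutoff_eq_integral {u : Distr n} {F : Sp n → Sp n → ℂ}
    (hF : ∀ y, Continuous (F y))
    (hFu : ∀ y (ψ : 𝓢(Sp n, ℂ)), cutoff (translate y χ) u ψ = ∫ x, F y x * ψ x) (y z x : Sp n) :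
    χ (x - z) * F y x = χ (x - y) * F z x := by
  refine congrFun (eq_of_forall_integral_test ((continuous_test_sub χ z).mul (hF y))
    ((continuous_test_sub χ y).mul (hF z)) fun φ => ?_) x
  have integral_eq (y z : Sp n) : ∫ x, φ x * (χ (x - z) * F y x) =
      u (mulTest (translate y χ) (mulTest (translate z χ) φ.toSchwartz).toSchwartz) := by
    rw [← cutoff_apply, hFu]
    simp only [Test.toSchwartz_apply, mulTest_apply, translate_apply, mul_comm (F y _), mul_assoc,
      mul_left_comm (φ _)]
  simp only [Pi.mul_apply, integral_eq]
  congr 1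
  ext x
  simp only [mulTest_apply, Test.toSchwartz_apply, mul_left_comm]

theorem exists_continuous_mul_eq (hχ : χ ≠ 0) {F : Sp n → Sp n → ℂ} (hF : ∀ y, Continuous (F y))
    (hcomm : ∀ y z x, χ (x - z) * F y x = χ (x - y) * F z x) :
    ∃ f : Sp n → ℂ, Continuous f ∧ ∀ y x, χ (x - y) * f x = F y x := by
  obtain ⟨x₀, hx₀⟩ := exists_test_apply_ne_zero hχ
  let f (x : Sp n) : ℂ := F (x - x₀) x / χ x₀
  have mul_f (y x) : χ (x - y) * f x = F y x := by
    have hx := hcomm y (x - x₀) x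
    rw [sub_sub_cancel] at hx
    rw [← mul_div_assoc, ← hx, mul_div_cancel_left₀ _ hx₀]
  refine ⟨f, continuous_iff_continuousAt.2 fun x => ?_, mul_f⟩
  have ne_zero : χ (x - (x - x₀)) ≠ 0 := by rwa [sub_sub_cancel]
  refine ((hF (x - x₀)).continuousAt.div (continuous_test_sub χ (x - x₀)).continuousAt
    ne_zero).congr ?_
  filter_upwards [(continuous_test_sub χ (x - x₀)).continuousAt.eventually_ne ne_zero] with z hz
  rw [Pi.div_apply, ← mul_f, mul_div_cancel_left₀ _ hz]

theorem exists_continuous_eq_ofFun {k : Sp n → ℝ} (hk : IsL2Weight k) {u : Distr n}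
    (hu : MemBInf k u) : ∃ f : Sp n → ℂ, Continuous f ∧ u = ofFun f := by
  obtain ⟨χ, hχ, hfin⟩ := hu
  have bNorm_lt (y) : bNorm k (cutoff (translate y χ) u) <
      ENNReal.ofReal ((ulNorm k χ u).toReal + 1) := by
    refine (le_iSup (fun y => bNorm k (cutoff (translate y χ) u)) y).trans_lt
      ((ENNReal.lt_ofReal_iff_toReal_lt hfin.ne).2 (lt_add_one _))
  choose F hF hFu using fun y =>
    exists_fourierRep_of_bNorm_lt hk (by positivity) (bNorm_lt y)
  have F_continuous (y) : Continuous (F y) := (hF y).continuous hk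
  obtain ⟨f, hf, hχf⟩ := exists_continuous_mul_eq hχ F_continuous
    (mul_comm_of_cutoff_eq_integral F_continuous hFu)
  refine ⟨f, hf, distr_ext_of_cutoff_translate hχ fun y => ?_⟩
  ext ψ
  simp only [hFu, cutoff_ofFun_apply hf, translate_apply, hχf]

end Gluing

section Neumann

variable {k : Sp n → ℝ} {C : ℝ} {ι : Type*} {w w' : ι → Sp n → ℂ} {e : Sp n → ℂ} {M δ η : ℝ}

theorem FourierRep.mul_pow (hk : IsAlgebraWeight k C) (he : FourierRep k e M) {v : Sp n → ℂ}
    (hv : FourierRep k v δ) (m : ℕ) : FourierRep k (fun x => e x * v x ^ m) (M * (C * δ) ^ m) := by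
  induction m with
  | zero => simpa only [pow_zero, mul_one] using he
  | succ m ih =>
    simp only [pow_succ, ← mul_assoc]
    exact (ih.mul hk hv).mono (by linarith)

/- In a Banach algebra a character is bounded by the spectral radius: apply the norm bound to the
powers of `v` and take roots. -/
theorem FourierRep.norm_le_const_mul (hk : IsAlgebraWeight k C) {v : Sp n → ℂ}
    (hv : FourierRep k v δ) (x : Sp n) : ‖v x‖ ≤ C * δ := by
  have hCδ : 0 ≤ C * δ := mul_nonneg hk.const_pos.le hv.nonneg
  by_contra! hlt
  have hpos : 0 < ‖v x‖ := hCδ.trans_lt hlt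
  have hbound (m : ℕ) : 1 ≤ invNorm k * δ / ‖v x‖ * (C * δ / ‖v x‖) ^ m := by
    have h := (hv.mul_pow hk hv m).norm_le hk.toIsL2Weight x
    rw [norm_mul, norm_pow] at h
    rw [div_pow, div_mul_div_comm, one_le_div (by positivity)]
    linarith
  have hlim := (tendsto_pow_atTop_nhds_zero_of_lt_one (by positivity)
    ((div_lt_one hpos).2 hlt)).const_mul (invNorm k * δ / ‖v x‖)
  rw [mul_zero] at hlim
  exact zero_lt_one.not_ge (ge_of_tendsto' hlim hbound)

theorem FourierRep.mul_inv_one_sub (hk : IsAlgebraWeight k C) (he : FourierRep k e M)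
    {v : Sp n → ℂ} (hv : FourierRep k v δ) (hδ : C * δ ≤ 1 / 2) :
    FourierRep k (fun x => e x * (1 - v x)⁻¹) (2 * M) := by
  have hM := he.nonneg
  have hCδ : 0 ≤ C * δ := mul_nonneg hk.const_pos.le hv.nonneg
  have hpow (m : ℕ) : FourierRep k (fun x => e x * v x ^ m) (M * (1 / 2) ^ m) :=
    (he.mul_pow hk hv m).mono (by gcongr)
  have hpartial (N : ℕ) :
      FourierRep k (fun x => ∑ m ∈ Finset.range N, e x * v x ^ m) (2 * M) := by
    refine (FourierRep.sum hk.toIsL2Weight (Finset.range N) fun m _ => hpow m).mono ?_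
    rw [← Finset.mul_sum, mul_comm]
    gcongr
    exact sum_le_hasSum (Finset.range N) (fun m _ => by positivity) hasSum_geometric_two
  refine FourierRep.of_tendsto hk.toIsL2Weight (l := atTop) hpartial fun x => ?_
  have hx : ‖v x‖ < 1 := (hv.norm_le_const_mul hk x).trans_lt (by linarith)
  exact ((hasSum_geometric_of_norm_lt_one hx).mul_left (e x)).tendsto_sum_nat

theorem FourierRep.mul_prod_inv_one_sub (hk : IsAlgebraWeight k C) (he : FourierRep k e M)
    (hw : ∀ j, FourierRep k (w j) δ) (hδ : C * δ ≤ 1 / 2) (s : Finset ι) :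
    FourierRep k (fun x => e x * ∏ j ∈ s, (1 - w j x)⁻¹) (2 ^ s.card * M) := by
  classical
  induction s using Finset.induction_on with
  | empty => simpa using he
  | insert i s hi ih =>
    rw [Finset.card_insert_of_notMem hi, pow_succ', mul_assoc]
    simp only [Finset.prod_insert hi]
    simpa only [mul_left_comm, mul_comm] using ih.mul_inv_one_sub hk (hw i) hδ

theorem FourierRep.mul_prod_inv_one_sub_sub (hk : IsAlgebraWeight k C) (he : FourierRep k e M)
    (hw : ∀ j, FourierRep k (w j) δ) (hw' : ∀ j, FourierRep k (w' j) δ) (hδ : C * δ ≤ 1 / 2)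
    (hη : ∀ j, FourierRep k (fun x => w j x - w' j x) η) (s : Finset ι) :
    FourierRep k (fun x => e x * (∏ j ∈ s, (1 - w j x)⁻¹ - ∏ j ∈ s, (1 - w' j x)⁻¹))
      (2 * s.card * 2 ^ s.card * (C * M * η)) := by
  classical
  have one_sub_ne_zero {v : Sp n → ℂ} (hv : FourierRep k v δ) (x : Sp n) : 1 - v x ≠ 0 := by
    have hx : ‖v x‖ < 1 := (hv.norm_le_const_mul hk x).trans_lt (by linarith)
    refine sub_ne_zero.2 fun h => hx.ne ?_
    rw [← h, norm_one]
  induction s using Finset.induction_on with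
  | empty => simpa using FourierRep.zero hk.toIsL2Weight
  | insert i s hi ih =>
    have hrest := ih.mul_inv_one_sub hk (hw i) hδ
    have hfactor := (((he.mul hk (hη i)).mul_inv_one_sub hk (hw i) hδ).mul_inv_one_sub hk
      (hw' i) hδ).mul_prod_inv_one_sub hk hw' hδ s
    rw [Finset.card_insert_of_notMem hi]
    simp only [Finset.prod_insert hi]
    convert hrest.add hk.toIsL2Weight hfactor using 1
    · funext x
      have hi := one_sub_ne_zero (hw i) x
      have hi' := one_sub_ne_zero (hw' i) x
      have resolvent : (1 - w i x)⁻¹ - (1 - w' i x)⁻¹ =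
          (w i x - w' i x) * (1 - w i x)⁻¹ * (1 - w' i x)⁻¹ := by
        field_simp
        ring
      linear_combination (e x * ∏ j ∈ s, (1 - w' j x)⁻¹) * resolvent
    · push_cast
      ring

end Neumann

section BandLimited

variable {d : ℕ} {b : Sp n → Fin d → ℂ} {R : ℝ}

/-- The pairing `-⟨x, ξ⟩ / 2π`, which turns the kernel `e^{-2πi L(ξ, x)}` of
`VectorFourier.fourierIntegral` into the kernel `e^{i⟨x, ξ⟩}` of `synth`. -/
def frequencyPairing (n : ℕ) : Sp n →L[ℝ] Sp n →L[ℝ] ℝ := (-(2 * Real.pi)⁻¹ : ℝ) • innerSL ℝ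

theorem frequencyPairing_apply (ξ x : Sp n) :
    frequencyPairing n ξ x = -(2 * Real.pi)⁻¹ * inner ℝ ξ x := rfl

theorem two_pi_mul_norm_frequencyPairing_le (n : ℕ) : 2 * Real.pi * ‖frequencyPairing n‖ ≤ 1 := by
  have hnorm : ‖frequencyPairing n‖ ≤ (2 * Real.pi)⁻¹ := by
    refine ContinuousLinearMap.opNorm_le_bound₂ _ (by positivity) fun ξ x => ?_
    rw [frequencyPairing_apply, norm_mul, norm_neg, Real.norm_of_nonneg (by positivity), mul_assoc]
    gcongr
    exact norm_inner_le_norm ξ x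
  calc 2 * Real.pi * ‖frequencyPairing n‖ ≤ 2 * Real.pi * (2 * Real.pi)⁻¹ := by gcongr
    _ = 1 := mul_inv_cancel₀ (by positivity)

theorem fourierChar_neg_frequencyPairing (ξ x : Sp n) :
    (Real.fourierChar (-(frequencyPairing n).toLinearMap₁₂ ξ x) : ℂ) = expI x ξ := by
  have hpairing : (frequencyPairing n).toLinearMap₁₂ ξ x = -(2 * Real.pi)⁻¹ * inner ℝ x ξ := by
    rw [real_inner_comm]
    exact frequencyPairing_apply ξ x
  rw [hpairing, Real.fourierChar_apply, expI]
  congr 1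
  have hpi : (Real.pi : ℂ) ≠ 0 := by exact_mod_cast Real.pi_ne_zero
  push_cast
  field_simp

theorem fourierIntegral_frequencyPairing (hb : Integrable b) :
    VectorFourier.fourierIntegral Real.fourierChar volume (frequencyPairing n).toLinearMap₁₂ b =
      fun x j => synth (fun ξ => b ξ j) x := by
  funext x j
  have hint : Integrable fun ξ =>
      Real.fourierChar (-(frequencyPairing n).toLinearMap₁₂ ξ x) • b ξ :=
    (VectorFourier.fourierIntegral_convergent_iff Real.continuous_fourierChar
      (frequencyPairing n).continuous₂ x).2 hb
  have hproj := (ContinuousLinearMap.proj (R := ℂ) (φ := fun _ : Fin d => ℂ) j).integral_comp_comm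
    hint
  simp only [ContinuousLinearMap.proj_apply, Pi.smul_apply, Circle.smul_def,
    fourierChar_neg_frequencyPairing, smul_eq_mul] at hproj
  simp only [VectorFourier.fourierIntegral, Circle.smul_def, fourierChar_neg_frequencyPairing]
  exact hproj.symm

theorem norm_pow_mul_norm_le_of_support (hsupp : ∀ ξ, R < ‖ξ‖ → b ξ = 0) (i : ℕ) (ξ : Sp n) :
    ‖ξ‖ ^ i * ‖b ξ‖ ≤ R ^ i * ‖b ξ‖ := by
  by_cases hξ : R < ‖ξ‖
  · simp only [hsupp ξ hξ, norm_zero, mul_zero, le_refl]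
  · gcongr
    exact not_lt.1 hξ

theorem integrable_norm_pow_mul_norm_of_support (hb : Integrable b)
    (hsupp : ∀ ξ, R < ‖ξ‖ → b ξ = 0) (i : ℕ) : Integrable fun ξ => ‖ξ‖ ^ i * ‖b ξ‖ := by
  refine (hb.norm.const_mul (R ^ i)).mono' ?_ (Eventually.of_forall fun ξ => ?_)
  · exact (continuous_norm.pow i).aestronglyMeasurable.mul hb.aestronglyMeasurable.norm
  · rw [Real.norm_of_nonneg (by positivity)]
    exact norm_pow_mul_norm_le_of_support hsupp i ξ

theorem contDiff_synth_of_support (hb : Integrable b) (hsupp : ∀ ξ, R < ‖ξ‖ → b ξ = 0) :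
    ContDiff ℝ ∞ fun x j => synth (fun ξ => b ξ j) x := by
  rw [← fourierIntegral_frequencyPairing hb]
  exact VectorFourier.contDiff_fourierIntegral (frequencyPairing n) fun i _ =>
    integrable_norm_pow_mul_norm_of_support hb hsupp i

theorem norm_iteratedFDeriv_synth_le_of_support (hb : Integrable b)
    (hsupp : ∀ ξ, R < ‖ξ‖ → b ξ = 0) (i : ℕ) (x : Sp n) :
    ‖iteratedFDeriv ℝ i (fun x j => synth (fun ξ => b ξ j) x) x‖ ≤ R ^ i * ∫ ξ, ‖b ξ‖ := by
  rw [← fourierIntegral_frequencyPairing hb, VectorFourier.iteratedFDeriv_fourierIntegral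
    (frequencyPairing n) (N := ⊤) (fun i _ => integrable_norm_pow_mul_norm_of_support hb hsupp i)
    hb.aestronglyMeasurable (by exact_mod_cast le_top), ← integral_const_mul]
  refine (VectorFourier.norm_fourierIntegral_le_integral_norm _ _ _ _ _).trans
    (integral_mono_of_nonneg (Eventually.of_forall fun ξ => norm_nonneg _)
      (hb.norm.const_mul _) (Eventually.of_forall fun ξ => ?_))
  calc ‖VectorFourier.fourierPowSMulRight (frequencyPairing n) b ξ i‖
      ≤ (2 * Real.pi * ‖frequencyPairing n‖) ^ i * (‖ξ‖ ^ i * ‖b ξ‖) := by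
        rw [← mul_assoc]
        exact VectorFourier.norm_fourierPowSMulRight_le _ b ξ i
    _ ≤ ‖ξ‖ ^ i * ‖b ξ‖ := mul_le_of_le_one_left (by positivity)
        (pow_le_one₀ (by positivity) (two_pi_mul_norm_frequencyPairing_le n))
    _ ≤ R ^ i * ‖b ξ‖ := norm_pow_mul_norm_le_of_support hsupp i ξ

end BandLimited

section Truncation

variable {k k' : Sp n → ℝ}

theorem exists_forall_le_mul_of_lt_norm (hk : ∀ ξ, 0 < k ξ)
    (hlim : Tendsto (fun ξ => k' ξ / k ξ) (cocompact (Sp n)) (𝓝 0)) {s : ℝ} (hs : 0 < s) :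
    ∃ R : ℝ, 0 ≤ R ∧ ∀ ξ, R < ‖ξ‖ → k' ξ ≤ s * k ξ := by
  obtain ⟨R, hR⟩ := Metric.closedBall_compl_subset_of_mem_cocompact
    (hlim.eventually (gt_mem_nhds hs)) (0 : Sp n)
  refine ⟨max R 0, le_max_right _ _, fun ξ hξ => ?_⟩
  have hlt : k' ξ / k ξ < s := hR (by simpa using (le_max_left R 0).trans_lt hξ)
  exact ((div_lt_iff₀ (hk ξ)).1 hlt).le

theorem integral_norm_pi_le {α ι : Type*} [Fintype ι] [MeasurableSpace α] {μ : Measure α}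
    {a : α → ι → ℂ} (ha : ∀ j, Integrable (fun x => a x j) μ) :
    ∫ x, ‖a x‖ ∂μ ≤ ∑ j, ∫ x, ‖a x j‖ ∂μ := by
  rw [← integral_finsetSum _ fun j _ => (ha j).norm]
  refine integral_mono_of_nonneg (Eventually.of_forall fun x => norm_nonneg _)
    (integrable_finsetSum _ fun j _ => (ha j).norm) (Eventually.of_forall fun x => ?_)
  refine (pi_norm_le_iff_of_nonneg (Finset.sum_nonneg fun j _ => norm_nonneg _)).2 fun j => ?_
  exact Finset.single_le_sum (f := fun j => ‖a x j‖) (fun j _ => norm_nonneg _)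
    (Finset.mem_univ j)

theorem fourierRep_synth_sub_indicator (hk : IsL2Weight k) (hk' : ∀ ξ, 0 < k' ξ) {R s M : ℝ}
    (hs : 0 ≤ s) (hR : ∀ ξ, R < ‖ξ‖ → k' ξ ≤ s * k ξ) (hM : 0 ≤ M) {a : Sp n → ℂ}
    (ha : Measurable a) (haM : eLpNorm (fun ξ => (k ξ : ℂ) * a ξ) 2 ≤ ENNReal.ofReal M) :
    FourierRep k' (fun x => synth a x - synth ((Metric.closedBall 0 R).indicator a) x)
      (s * M) := by
  have hball : MeasurableSet (Metric.closedBall (0 : Sp n) R) := measurableSet_closedBall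
  have hint := hk.integrable ha.aestronglyMeasurable haM
  refine ⟨by positivity, fun ξ => a ξ - (Metric.closedBall 0 R).indicator a ξ,
    (ha.sub (ha.indicator hball)).aestronglyMeasurable, ?_, ?_⟩
  · rw [ENNReal.ofReal_mul hs]
    refine le_trans ?_ (mul_le_mul_right haM _)
    refine eLpNorm_le_mul_eLpNorm_of_ae_le_mul (Eventually.of_forall fun ξ => ?_) 2
    by_cases hξ : ξ ∈ Metric.closedBall (0 : Sp n) R
    · simp only [Set.indicator_of_mem hξ, sub_self, mul_zero, norm_zero]
      positivity
    · simp only [Set.indicator_of_notMem hξ, sub_zero, norm_mul, Complex.norm_real,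
        Real.norm_of_nonneg (hk.pos ξ).le, Real.norm_of_nonneg (hk' ξ).le, ← mul_assoc]
      gcongr
      exact hR ξ (by simpa using hξ)
  · funext x
    simp only [synth, mul_sub]
    exact (integral_sub (integrable_expI_mul hint x)
      (integrable_expI_mul (hint.indicator hball) x)).symm

theorem exists_contDiff_fourierRep_sub (hk : IsL2Weight k) (hk' : ∀ ξ, 0 < k' ξ)
    (hlim : Tendsto (fun ξ => k' ξ / k ξ) (cocompact (Sp n)) (𝓝 0)) (d : ℕ) {M δ : ℝ}
    (hM : 0 ≤ M) (hδ : 0 < δ) :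
    ∃ D : ℝ, 1 ≤ D ∧ ∀ h : Sp n → Fin d → ℂ, (∀ j, FourierRep k (fun x => h x j) M) →
      ∃ v : Sp n → Fin d → ℂ, ContDiff ℝ ∞ v ∧
        (∀ i, 1 ≤ i → ∀ x, ‖iteratedFDeriv ℝ i v x‖ ≤ D ^ i) ∧
        ∀ j, FourierRep k' (fun x => h x j - v x j) δ := by
  obtain ⟨R, hR₀, hR⟩ :=
    exists_forall_le_mul_of_lt_norm hk.pos hlim (by positivity : 0 < δ / (M + 1))
  let A : ℝ := d * (invNorm k * M)
  have hA : 0 ≤ A := mul_nonneg (Nat.cast_nonneg d) (mul_nonneg (invNorm_nonneg k) hM)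
  refine ⟨(R + 1) * (A + 1), by nlinarith, fun h hh => ?_⟩
  choose a ha haM hha using fun j => (hh j).exists_measurable
  have hint (j) : Integrable ((Metric.closedBall 0 R).indicator (a j)) :=
    (hk.integrable (ha j).aestronglyMeasurable (haM j)).indicator measurableSet_closedBall
  let b : Sp n → Fin d → ℂ := fun ξ j => (Metric.closedBall 0 R).indicator (a j) ξ
  have hb : Integrable b := Integrable.of_eval hint
  have hbA : ∫ ξ, ‖b ξ‖ ≤ A :=
    calc ∫ ξ, ‖b ξ‖ ≤ ∑ j, ∫ ξ, ‖b ξ j‖ := integral_norm_pi_le hint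
      _ ≤ ∑ _j : Fin d, invNorm k * M := Finset.sum_le_sum fun j _ =>
          (integral_mono (hint j).norm (hk.integrable (ha j).aestronglyMeasurable (haM j)).norm
            fun ξ => norm_indicator_le_norm_self _ _).trans
            (hk.integral_norm_le (ha j).aestronglyMeasurable hM (haM j))
      _ = A := by simp [A]
  have hsupp (ξ) (hξ : R < ‖ξ‖) : b ξ = 0 :=
    funext fun j => Set.indicator_of_notMem (by simpa using hξ) _
  refine ⟨fun x j => synth (fun ξ => b ξ j) x, contDiff_synth_of_support hb hsupp,
    fun i hi x => (norm_iteratedFDeriv_synth_le_of_support hb hsupp i x).trans ?_, fun j => ?_⟩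
  · rw [mul_pow]
    gcongr
    · linarith
    · exact hbA.trans ((by linarith : A ≤ A + 1).trans (le_self_pow₀ (by linarith) (by lia)))
  · have hhx (x) : h x j = synth (a j) x := congrFun (hha j) x
    simp only [hhx]
    refine (fourierRep_synth_sub_indicator hk hk' (by positivity) hR hM (ha j) (haM j)).mono ?_
    rw [div_mul_eq_mul_div, div_le_iff₀ (by positivity)]
    nlinarith

end Truncation

section Extension

theorem exists_schwartz_eq_of_differentiableOn {d : ℕ} {Ω S : Set (Fin d → ℂ)} (hΩ : IsOpen Ω)
    {Φ : (Fin d → ℂ) → ℂ} (hΦ : DifferentiableOn ℂ Φ Ω) (hS : IsCompact S) (hSΩ : S ⊆ Ω) :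
    ∃ r > 0, ∃ G : 𝓢((Fin d → ℂ), ℂ), ∀ p ∈ S, ∀ z, dist z p ≤ 2 * r → z ∈ Ω ∧ G z = Φ z := by
  obtain ⟨R, hR, hRΩ⟩ := hS.exists_cthickening_subset_open hΩ hSΩ
  have hsub : Metric.cthickening (R / 2) S ⊆ interior (Metric.cthickening R S) :=
    (Metric.cthickening_subset_thickening' hR (by linarith) S).trans
      (interior_maximal (Metric.thickening_subset_cthickening R S) Metric.isOpen_thickening)
  obtain ⟨κ, hκ_one, hκ_zero, -⟩ := exists_contMDiffMap_one_nhds_of_subset_interior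
    (n := ⊤) (modelWithCornersSelf ℝ (Fin d → ℂ)) Metric.isClosed_cthickening hsub
  have hκ : ContDiff ℝ ∞ κ := κ.contMDiff.contDiff
  have hsmooth : ContDiff ℝ ∞ fun z => (κ z : ℂ) * Φ z := by
    refine contDiff_iff_contDiffAt.2 fun z => ?_
    by_cases hz : z ∈ Metric.cthickening R S
    · exact (Complex.ofRealCLM.contDiff.comp hκ).contDiffAt.mul
        (((contDiffOn_of_differentiableOn_pi hΩ hΦ ∞).contDiffAt
          (hΩ.mem_nhds (hRΩ hz))).restrict_scalars ℝ)
    · refine (contDiffAt_const (c := (0 : ℂ))).congr_of_eventuallyEq ?_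
      filter_upwards [Metric.isClosed_cthickening.isOpen_compl.mem_nhds hz] with x hx
      rw [hκ_zero x hx, Complex.ofReal_zero, zero_mul]
  have hcompact : HasCompactSupport fun z => (κ z : ℂ) * Φ z := by
    refine HasCompactSupport.intro (hS.cthickening (r := R)) fun z hz => ?_
    rw [hκ_zero z hz, Complex.ofReal_zero, zero_mul]
  refine ⟨R / 4, by positivity, hcompact.toSchwartzMap hsmooth, fun p hp z hz => ?_⟩
  have hzS : z ∈ Metric.cthickening (R / 2) S :=
    Metric.mem_cthickening_of_dist_le z p _ S hp (by linarith)
  refine ⟨hRΩ (interior_subset (hsub hzS)), ?_⟩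
  change (κ z : ℂ) * Φ z = Φ z
  rw [hκ_one.self_of_nhdsSet z hzS, Complex.ofReal_one, one_mul]

theorem exists_test_eqOn_one {K : Set (Sp n)} (hK : IsCompact K) :
    ∃ χ : Test n, ∀ x ∈ K, χ x = 1 := by
  obtain ⟨ρ, hρ, hsub⟩ := hK.isBounded.subset_closedBall_lt 0 (0 : Sp n)
  let B : ContDiffBump (0 : Sp n) := ⟨ρ, ρ + 1, hρ, by linarith⟩
  refine ⟨{ toFun := fun x => (B x : ℂ)
            contDiff' := Complex.ofRealCLM.contDiff.comp B.contDiff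
            hasCompactSupport' := B.hasCompactSupport.comp_left Complex.ofReal_zero
            tsupport_subset' := fun _ _ => trivial }, fun x hx => ?_⟩
  change (B x : ℂ) = 1
  rw [B.one_of_mem_closedBall (hsub hx), Complex.ofReal_one]

theorem exists_test_ne_zero (n : ℕ) : ∃ χ : Test n, χ ≠ 0 := by
  obtain ⟨χ, hχ⟩ := exists_test_eqOn_one (isCompact_singleton (x := (0 : Sp n)))
  refine ⟨χ, fun h => one_ne_zero (α := ℂ) ?_⟩
  rw [← hχ 0 rfl, h]
  rfl

end Extension

section PolydiscCauchy

variable {d : ℕ} {r : ℝ} {F G : (Fin d → ℂ) → ℂ} {p h h' : Fin d → ℂ}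

/-- Cauchy's integral of `G` over the torus of radius `r` about `p`, evaluated at `p + h`. The
kernel is normalized so that it expands in a Neumann series in `h`. -/
def polydiscCauchy (r : ℝ) (G : (Fin d → ℂ) → ℂ) (p h : Fin d → ℂ) : ℂ :=
  ((2 * Real.pi : ℂ) ^ d)⁻¹ * ∫ θ in Set.Icc (0 : Fin d → ℝ) fun _ => 2 * Real.pi,
    G (p + torusMap 0 (fun _ => r) θ) * ∏ j, (1 - (torusMap 0 (fun _ => r) θ j)⁻¹ * h j)⁻¹

theorem polydiscCauchy_eq (hr : 0 ≤ r) (hh : ∀ j, ‖h j‖ < r)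
    (hF : DifferentiableOn ℂ F (Metric.closedBall p r))
    (hGF : Set.EqOn G F (Metric.closedBall p r)) : polydiscCauchy r G p h = F (p + h) := by
  rw [closedBall_pi p hr] at hF hGF
  rw [eq_integral_torus_prod_smul hh hF, polydiscCauchy, smul_eq_mul]
  congr 2
  funext θ
  have hθ : p + torusMap 0 (fun _ => r) θ ∈ Set.univ.pi fun j => Metric.closedBall (p j) r := by
    rw [← torusMap_sub_center p, add_sub_cancel]
    exact torusMap_mem_pi_closedBall p (fun _ => hr) θ
  rw [hGF hθ, smul_eq_mul, mul_comm]

theorem norm_torusMap_zero_apply (hr : 0 ≤ r) (θ : Fin d → ℝ) (j : Fin d) :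
    ‖torusMap 0 (fun _ => r) θ j‖ = r := by
  simpa [abs_of_nonneg hr] using dist_torusMap_apply 0 (fun _ => r) θ j

theorem continuous_polydiscCauchy_integrand (hG : Continuous G) (hh : ∀ j, ‖h j‖ < r) :
    Continuous fun θ : Fin d → ℝ => G (p + torusMap 0 (fun _ => r) θ) *
      ∏ j, (1 - (torusMap 0 (fun _ => r) θ j)⁻¹ * h j)⁻¹ := by
  have htorus := continuous_torusMap (0 : Fin d → ℂ) fun _ => r
  refine (hG.comp (continuous_const.add htorus)).mul (continuous_finsetProd _ fun j _ => ?_)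
  have hr : 0 < r := (norm_nonneg _).trans_lt (hh j)
  have hnorm := norm_torusMap_zero_apply (d := d) hr.le
  refine Continuous.inv₀ (continuous_const.sub (Continuous.mul (Continuous.inv₀
    ((continuous_apply j).comp htorus) fun θ => ?_) continuous_const)) fun θ => ?_
  · exact norm_pos_iff.1 (hr.trans_eq (hnorm θ j).symm)
  · exact one_sub_inv_mul_ne_zero ((hh j).trans_eq (hnorm θ j).symm)

theorem polydiscCauchy_sub (hG : Continuous G) (hh : ∀ j, ‖h j‖ < r) (hh' : ∀ j, ‖h' j‖ < r) :
    polydiscCauchy r G p h - polydiscCauchy r G p h' =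
      ((2 * Real.pi : ℂ) ^ d)⁻¹ * ∫ θ in Set.Icc (0 : Fin d → ℝ) fun _ => 2 * Real.pi,
        G (p + torusMap 0 (fun _ => r) θ) *
          (∏ j, (1 - (torusMap 0 (fun _ => r) θ j)⁻¹ * h j)⁻¹ -
            ∏ j, (1 - (torusMap 0 (fun _ => r) θ j)⁻¹ * h' j)⁻¹) := by
  simp only [polydiscCauchy, mul_sub]
  rw [integral_sub (continuous_polydiscCauchy_integrand hG hh).integrableOn_Icc
    (continuous_polydiscCauchy_integrand hG hh').integrableOn_Icc, mul_sub]

end PolydiscCauchy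

section CauchyEstimates

variable {k : Sp n → ℝ} {C M r δ η : ℝ} {d : ℕ} {e : Sp n → ℂ} {G : (Fin d → ℂ) → ℂ}
  {v h h' : Sp n → Fin d → ℂ}

theorem FourierRep.torusAverage (hk : IsL2Weight k) {F : (Fin d → ℝ) → Sp n → ℂ}
    (hF : ∀ θ, FourierRep k (F θ) M) (hcont : ∀ x, Continuous fun θ => F θ x) :
    FourierRep k (fun x => ((2 * Real.pi : ℂ) ^ d)⁻¹ *
      ∫ θ in Set.Icc (0 : Fin d → ℝ) fun _ => 2 * Real.pi, F θ x) M := by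
  have hint := FourierRep.integral hk
    (μ := volume.restrict (Set.Icc (0 : Fin d → ℝ) fun _ => 2 * Real.pi)) (M := fun _ => M) hF
    continuous_const.integrableOn_Icc fun x => (hcont x).integrableOn_Icc
  refine (hint.const_mul hk _).mono (le_of_eq ?_)
  have hvol : volume.real (Set.Icc (0 : Fin d → ℝ) fun _ => 2 * Real.pi) = (2 * Real.pi) ^ d := by
    rw [Measure.real, Real.volume_Icc_pi_toReal fun _ => by positivity]
    simp
  have hnorm : ‖(2 * Real.pi : ℂ) ^ d‖ = (2 * Real.pi) ^ d := by
    simpa using norm_two_pi_pow d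
  rw [setIntegral_const, hvol, smul_eq_mul, norm_inv, hnorm, inv_mul_cancel_left₀ (by positivity)]

theorem FourierRep.torusMap_inv_mul (hk : IsL2Weight k) (hr : 0 ≤ r)
    (hh : ∀ j, FourierRep k (fun x => h x j) δ) (θ : Fin d → ℝ) (j : Fin d) :
    FourierRep k (fun x => (torusMap 0 (fun _ => r) θ j)⁻¹ * h x j) (r⁻¹ * δ) := by
  simpa only [norm_inv, norm_torusMap_zero_apply hr] using
    (hh j).const_mul hk (torusMap 0 (fun _ => r) θ j)⁻¹

theorem FourierRep.norm_lt_of_mul_le (hk : IsAlgebraWeight k C) (hr : 0 < r)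
    (hδ : C * (r⁻¹ * δ) ≤ 1 / 2) {f : Sp n → ℂ} (hf : FourierRep k f δ) (x : Sp n) :
    ‖f x‖ < r := by
  have hδr : C * δ ≤ 1 / 2 * r := by
    rwa [mul_left_comm, inv_mul_le_iff₀ hr, mul_comm r] at hδ
  linarith [hf.norm_le_const_mul hk x]

theorem FourierRep.mul_polydiscCauchy (hk : IsAlgebraWeight k C) (hr : 0 < r) (hG : Continuous G)
    (he : ∀ c, FourierRep k (fun x => e x * G (v x + c)) M)
    (hh : ∀ j, FourierRep k (fun x => h x j) δ) (hδ : C * (r⁻¹ * δ) ≤ 1 / 2) :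
    FourierRep k (fun x => e x * polydiscCauchy r G (v x) (h x)) (2 ^ d * M) := by
  have hterm (θ : Fin d → ℝ) := (he (torusMap 0 (fun _ => r) θ)).mul_prod_inv_one_sub hk
    (FourierRep.torusMap_inv_mul hk.toIsL2Weight hr.le hh θ) hδ Finset.univ
  simp only [Finset.card_univ, Fintype.card_fin, mul_assoc] at hterm
  have havg := FourierRep.torusAverage hk.toIsL2Weight hterm fun x =>
    continuous_const.mul (continuous_polydiscCauchy_integrand hG fun j =>
      (hh j).norm_lt_of_mul_le hk hr hδ x)
  simpa only [integral_const_mul, polydiscCauchy, mul_left_comm] using havg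

theorem FourierRep.mul_polydiscCauchy_sub (hk : IsAlgebraWeight k C) (hr : 0 < r)
    (hG : Continuous G) (he : ∀ c, FourierRep k (fun x => e x * G (v x + c)) M)
    (hh : ∀ j, FourierRep k (fun x => h x j) δ) (hh' : ∀ j, FourierRep k (fun x => h' x j) δ)
    (hδ : C * (r⁻¹ * δ) ≤ 1 / 2) (hη : ∀ j, FourierRep k (fun x => h x j - h' x j) η) :
    FourierRep k (fun x => e x *
        (polydiscCauchy r G (v x) (h x) - polydiscCauchy r G (v x) (h' x)))
      (2 * d * 2 ^ d * (C * M * (r⁻¹ * η))) := by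
  have hw (θ) := FourierRep.torusMap_inv_mul hk.toIsL2Weight hr.le hη θ
  simp only [mul_sub (torusMap _ _ _ _)⁻¹] at hw
  have hterm (θ : Fin d → ℝ) := (he (torusMap 0 (fun _ => r) θ)).mul_prod_inv_one_sub_sub hk
    (FourierRep.torusMap_inv_mul hk.toIsL2Weight hr.le hh θ)
    (FourierRep.torusMap_inv_mul hk.toIsL2Weight hr.le hh' θ) hδ (hw θ) Finset.univ
  simp only [Finset.card_univ, Fintype.card_fin, mul_assoc (e _)] at hterm
  have hlt (x j) := (hh j).norm_lt_of_mul_le hk hr hδ x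
  have hlt' (x j) := (hh' j).norm_lt_of_mul_le hk hr hδ x
  have havg := FourierRep.torusAverage hk.toIsL2Weight hterm fun x => by
    simp only [mul_sub (G _)]
    exact continuous_const.mul ((continuous_polydiscCauchy_integrand hG (hlt x)).sub
      (continuous_polydiscCauchy_integrand hG (hlt' x)))
  convert havg using 2 with x
  rw [polydiscCauchy_sub hG (hlt x) (hlt' x), integral_const_mul, mul_left_comm]

end CauchyEstimates

section WeightComparison

variable {k k' : Sp n → ℝ} {C : ℝ}

theorem IsKpol.exists_add_le_of_norm_le (hk : IsKpol k) (R : ℝ) :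
    ∃ D : ℝ, 0 ≤ D ∧ ∀ ξ η, ‖ξ‖ ≤ R → k (ξ + η) ≤ D * k η := by
  obtain ⟨-, hpos, C, N, hC, hN, hle⟩ := hk
  refine ⟨C * (1 + |R|) ^ N, by positivity, fun ξ η hξ => (hle ξ η).trans ?_⟩
  have hb : bracket ξ ≤ 1 + |R| := (bracket_le ξ).trans (by linarith [le_abs_self R])
  have hb0 : 0 ≤ bracket ξ := zero_le_one.trans (one_le_bracket ξ)
  have := (hpos η).le
  gcongr

theorem exists_le_mul_of_tendsto (hk : IsKpol k) (hk' : IsKpol k')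
    (hlim : Tendsto (fun ξ => k' ξ / k ξ) (cocompact (Sp n)) (𝓝 0)) :
    ∃ c : ℝ, ∀ ξ, k' ξ ≤ c * k ξ := by
  obtain ⟨R, -, hR⟩ := exists_forall_le_mul_of_lt_norm hk.2.1 hlim one_pos
  obtain ⟨D, hD, hkD⟩ := hk.exists_add_le_of_norm_le R
  obtain ⟨D', hD', hkD'⟩ := hk'.exists_add_le_of_norm_le R
  have h0 := hk.2.1 0
  have h0' := hk'.2.1 0
  refine ⟨D' * k' 0 * (D / k 0) + 1, fun ξ => ?_⟩
  have hξ := hk.2.1 ξ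
  obtain hξR | hξR := le_or_gt ‖ξ‖ R
  · have upper : k' ξ ≤ D' * k' 0 := by simpa using hkD' ξ 0 hξR
    have lower : k 0 ≤ D * k ξ := by simpa using hkD (-ξ) ξ (by simpa using hξR)
    calc k' ξ ≤ D' * k' 0 * (k 0 / k 0) := by rwa [div_self h0.ne', mul_one]
      _ ≤ D' * k' 0 * (D * k ξ / k 0) := by gcongr
      _ = D' * k' 0 * (D / k 0) * k ξ := by ring
      _ ≤ (D' * k' 0 * (D / k 0) + 1) * k ξ := by gcongr; linarith
  · refine (hR ξ hξR).trans ?_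
    gcongr
    exact le_add_of_nonneg_left (by positivity)

theorem IsL2Weight.of_le_mul (hk' : IsL2Weight k') (hmeas : Measurable k) (hpos : ∀ ξ, 0 < k ξ)
    {c : ℝ} (hle : ∀ ξ, k' ξ ≤ c * k ξ) : IsL2Weight k := by
  refine ⟨hmeas, hpos, hk'.memLp.of_le_mul (c := c)
    (measurable_const.div hmeas).aestronglyMeasurable (Eventually.of_forall fun ξ => ?_)⟩
  have hξ := hpos ξ
  have hξ' := hk'.pos ξ
  rw [Real.norm_of_nonneg (by positivity), Real.norm_of_nonneg (by positivity), mul_one_div,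
    div_le_div_iff₀ hξ hξ', one_mul]
  exact hle ξ

theorem IsKa.exists_isAlgebraWeight (hk : IsKa k) (hL2 : MemLp (fun ξ => 1 / k ξ) 2 volume) :
    ∃ C, IsAlgebraWeight k C :=
  let ⟨C, hC, hconv⟩ := hk.2
  ⟨C, ⟨⟨hk.1.1, hk.1.2.1, hL2⟩, hC, hconv⟩⟩

end WeightComparison

section ContinuousRepresentatives

variable {k : Sp n → ℝ} {χ : Test n} {M : ℝ} {d : ℕ} {u : Fin d → Distr n}
  {f : Sp n → Fin d → ℂ}

theorem existsUnique_isContRep (hk : IsL2Weight k) (hu : ∀ j, MemBInf k (u j)) :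
    ∃! f, IsContRep u f := by
  choose f hfc hfu using fun j => exists_continuous_eq_ofFun hk (hu j)
  refine ⟨fun x j => f j x, ⟨continuous_pi hfc, hfu⟩, fun g hg => ?_⟩
  funext x j
  exact congrFun (eq_of_ofFun_eq ((continuous_apply j).comp hg.1) (hfc j)
    ((hg.2 j).symm.trans (hfu j))) x

theorem WindowRep.norm_le (hk : IsL2Weight k) {f : Sp n → ℂ} (hf : WindowRep k χ f M) {x₀ : Sp n}
    (hx₀ : χ x₀ ≠ 0) (x : Sp n) : ‖f x‖ ≤ invNorm k * M / ‖χ x₀‖ := by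
  have hx := (hf (x - x₀)).norm_le hk x
  rwa [sub_sub_cancel, norm_mul, mul_comm, ← le_div_iff₀ (norm_pos_iff.2 hx₀)] at hx

theorem exists_windowRep_of_memBInf (hk : IsL2Weight k) (hpol : IsKpol k) {f : Sp n → ℂ}
    (hf : Continuous f) (hmem : MemBInf k (ofFun f)) (χ : Test n) :
    ∃ M : ℝ, 0 ≤ M ∧ WindowRep k χ f M := by
  obtain ⟨χ₁, hχ₁, hfin⟩ := hmem
  obtain ⟨C, hC, htransfer⟩ := exists_windowRep_of_windowRep hk hpol hχ₁ χ
  have hlt := (ENNReal.lt_ofReal_iff_toReal_lt hfin.ne).2 (lt_add_one _)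
  exact ⟨_, by positivity, htransfer _ _ (windowRep_of_ulNorm_lt hk hf (by positivity) hlt)⟩

theorem IsContRep.exists_windowRep (hk : IsL2Weight k) (hpol : IsKpol k) (hf : IsContRep u f)
    (hu : ∀ j, MemBInf k (u j)) (χ : Test n) :
    ∃ M : ℝ, 0 ≤ M ∧ ∀ j, WindowRep k χ (fun x => f x j) M := by
  choose M hM hfM using fun j => exists_windowRep_of_memBInf hk hpol
    ((continuous_apply j).comp hf.1) (hf.2 j ▸ hu j) χ
  exact ⟨∑ j, M j, Finset.sum_nonneg fun j _ => hM j, fun j y => (hfM j y).mono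
    (Finset.single_le_sum (f := M) (fun j _ => hM j) (Finset.mem_univ j))⟩

theorem IsContRep.isCompact_closure_range (hk : IsL2Weight k) (hpol : IsKpol k)
    (hf : IsContRep u f) (hu : ∀ j, MemBInf k (u j)) : IsCompact (closure (Set.range f)) := by
  obtain ⟨χ, hχ⟩ := exists_test_ne_zero n
  obtain ⟨x₀, hx₀⟩ := exists_test_apply_ne_zero hχ
  obtain ⟨M, hM, hfM⟩ := hf.exists_windowRep hk hpol hu χ
  refine (isBounded_iff_forall_norm_le.2
    ⟨invNorm k * M / ‖χ x₀‖, Set.forall_mem_range.2 fun x => ?_⟩).isCompact_closure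
  have := invNorm_nonneg k
  exact (pi_norm_le_iff_of_nonneg (by positivity)).2 fun j => (hfM j).norm_le hk hx₀ x

end ContinuousRepresentatives

section Composition

variable {d : ℕ} {Ω : Set (Fin d → ℂ)} {Φ G : (Fin d → ℂ) → ℂ}

theorem mul_polydiscCauchy_eq_mul {r : ℝ} (hr : 0 ≤ r) (hΦ : DifferentiableOn ℂ Φ Ω)
    {a b : ℂ} (hab : a ≠ 0 → b = 1) {p q z : Fin d → ℂ}
    (hG : ∀ w, dist w q ≤ 2 * r → w ∈ Ω ∧ G w = Φ w) (hq : ∀ j, ‖b * q j - p j‖ < r)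
    (hz : ∀ j, ‖b * z j - p j‖ < r) :
    a * polydiscCauchy r G p (fun j => b * z j - p j) = a * Φ z := by
  obtain rfl | ha := eq_or_ne a 0
  · simp only [zero_mul]
  obtain rfl := hab ha
  simp only [one_mul] at hq hz ⊢
  have hqp : dist p q ≤ r := (dist_pi_le_iff hr).2 fun j => by
    rw [dist_comm, dist_eq_norm]
    exact (hq j).le
  have hball (w) (hw : w ∈ Metric.closedBall p r) : w ∈ Ω ∧ G w = Φ w :=
    hG w (by linarith [dist_triangle w p q, Metric.mem_closedBall.1 hw])
  rw [polydiscCauchy_eq hr hz (hΦ.mono fun w hw => (hball w hw).1) fun w hw => (hball w hw).2]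
  congr 2
  funext j
  simp

variable {k k' : Sp n → ℝ} {C M r δ η : ℝ} {u : Fin d → Distr n} {e w : Sp n → ℂ}
  {f g g' v : Sp n → Fin d → ℂ}

theorem FourierRep.mul_comp_and_mul_comp_sub (hk : IsAlgebraWeight k C) (hr : 0 < r)
    (hΦ : DifferentiableOn ℂ Φ Ω) (hGc : Continuous G)
    (hG : ∀ x z, dist z (f x) ≤ 2 * r → z ∈ Ω ∧ G z = Φ z) (hew : ∀ x, e x ≠ 0 → w x = 1)
    (he : ∀ c, FourierRep k (fun x => e x * G (v x + c)) M) (hδ : C * (r⁻¹ * (δ + δ)) ≤ 1 / 2)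
    (hv : ∀ j, FourierRep k (fun x => w x * f x j - v x j) δ)
    (hg : ∀ j, FourierRep k (fun x => w x * (g x j - f x j)) δ)
    (hg' : ∀ j, FourierRep k (fun x => w x * (g' x j - f x j)) δ)
    (hη : ∀ j, FourierRep k (fun x => w x * (g x j - g' x j)) η) :
    FourierRep k (fun x => e x * Φ (g x)) (2 ^ d * M) ∧
      FourierRep k (fun x => e x * (Φ (g x) - Φ (g' x)))
        (2 * d * 2 ^ d * (C * M * (r⁻¹ * η))) := by
  have hsub {g : Sp n → Fin d → ℂ}
      (hg : ∀ j, FourierRep k (fun x => w x * (g x j - f x j)) δ) (j : Fin d) :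
      FourierRep k (fun x => w x * g x j - v x j) (δ + δ) := by
    simpa only [mul_sub, sub_add_sub_cancel] using (hg j).add hk.toIsL2Weight (hv j)
  have cauchy {g : Sp n → Fin d → ℂ}
      (hg : ∀ j, FourierRep k (fun x => w x * (g x j - f x j)) δ) (x : Sp n) :
      e x * polydiscCauchy r G (v x) (fun j => w x * g x j - v x j) = e x * Φ (g x) :=
    mul_polydiscCauchy_eq_mul hr.le hΦ (hew x) (hG x)
      (fun j => ((hv j).mono (le_add_of_nonneg_right (hv j).nonneg)).norm_lt_of_mul_le hk hr hδ x)
      fun j => (hsub hg j).norm_lt_of_mul_le hk hr hδ x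
  constructor
  · simpa only [cauchy hg] using
      FourierRep.mul_polydiscCauchy hk hr hGc he (hsub hg) hδ
  · have hdiff := FourierRep.mul_polydiscCauchy_sub hk hr hGc he (hsub hg) (hsub hg') hδ
      fun j => by simpa only [sub_sub_sub_cancel_right, ← mul_sub] using hη j
    simpa only [mul_sub, cauchy hg, cauchy hg'] using hdiff

theorem exists_windowRep_comp (hΩ : IsOpen Ω) (hΦ : DifferentiableOn ℂ Φ Ω) (hk : IsL2Weight k)
    (hpol : IsKpol k) (hk' : IsAlgebraWeight k' C) (hpol' : IsKpol k')
    (hlim : Tendsto (fun ξ => k' ξ / k ξ) (cocompact (Sp n)) (𝓝 0)) (hf : IsContRep u f)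
    (hu : ∀ j, MemBInf k (u j)) (hfΩ : closure (Set.range f) ⊆ Ω) (χ : Test n) :
    ∃ (χ₁ : Test n) (δ C₁ C₂ : ℝ), 0 < δ ∧ 0 ≤ C₂ ∧ ∀ (g g' : Sp n → Fin d → ℂ) (η : ℝ),
      (∀ j, WindowRep k' χ₁ (fun x => g x j - f x j) δ) →
      (∀ j, WindowRep k' χ₁ (fun x => g' x j - f x j) δ) →
      (∀ j, WindowRep k' χ₁ (fun x => g x j - g' x j) η) →
      WindowRep k' χ (fun x => Φ (g x)) C₁ ∧
        WindowRep k' χ (fun x => Φ (g x) - Φ (g' x)) (C₂ * η) := by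
  have hC := hk'.const_pos
  obtain ⟨χ₁, hχ₁⟩ := exists_test_eqOn_one χ.hasCompactSupport.isCompact
  obtain ⟨M, hM, hfM⟩ := hf.exists_windowRep hk hpol hu χ₁
  obtain ⟨r, hr, G, hG⟩ := exists_schwartz_eq_of_differentiableOn hΩ hΦ
    (hf.isCompact_closure_range hk hpol hu) hfΩ
  obtain ⟨δ, hδ, hCδ⟩ : ∃ δ > 0, C * (r⁻¹ * (δ + δ)) ≤ 1 / 2 :=
    ⟨r / (4 * C), by positivity, le_of_eq (by field_simp; norm_num)⟩
  obtain ⟨D, hD, htrunc⟩ := exists_contDiff_fourierRep_sub hk hk'.pos hlim d hM hδ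
  obtain ⟨m, M₀, hM₀, hcomp⟩ := exists_fourierRep_test_mul_comp hpol' χ G hD
  refine ⟨χ₁, δ, 2 ^ d * M₀, 2 * d * 2 ^ d * (C * M₀ * r⁻¹), hδ, by positivity,
    fun g g' η hg hg' hη => forall_and.1 fun y => ?_⟩
  obtain ⟨v, hv, hvD, hvδ⟩ := htrunc (fun x j => χ₁ (x - y) * f x j) fun j => hfM j y
  obtain ⟨hΦg, hΦsub⟩ := FourierRep.mul_comp_and_mul_comp_sub hk' hr hΦ G.continuous
    (fun x => hG (f x) (subset_closure ⟨x, rfl⟩))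
    (fun x hx => hχ₁ _ (subset_tsupport χ hx))
    (hcomp v hv (fun i hi _ => hvD i hi) · y) hCδ hvδ (fun j => hg j y) (fun j => hg' j y)
    fun j => hη j y
  exact ⟨hΦg, hΦsub.mono (le_of_eq (by ring))⟩

end Composition

section Convergence

variable {ι : Type*} {l : Filter ι} {k k' : Sp n → ℝ} {χ : Test n}

/-- Convergence of continuous functions in `(ℬ_k^∞)^d`, with respect to all windows at once. -/
def WindowTendsto {d : ℕ} (k : Sp n → ℝ) (g : ι → Sp n → Fin d → ℂ) (l : Filter ι)
    (f : Sp n → Fin d → ℂ) : Prop :=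
  ∀ (χ : Test n) (δ : ℝ), 0 < δ → ∀ᶠ i in l, ∀ j, WindowRep k χ (fun x => g i x j - f x j) δ

theorem eventually_windowRep_of_tendsto_ulNorm (hk : IsL2Weight k) (hpol : IsKpol k) (hχ : χ ≠ 0)
    {h : ι → Sp n → ℂ} (hh : ∀ᶠ i in l, Continuous (h i))
    (hlim : Tendsto (fun i => ulNorm k χ (ofFun (h i))) l (𝓝 0)) (χ' : Test n) {δ : ℝ}
    (hδ : 0 < δ) : ∀ᶠ i in l, WindowRep k χ' (h i) δ := by
  obtain ⟨C, hC, htransfer⟩ := exists_windowRep_of_windowRep hk hpol hχ χ'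
  have hM : 0 < (2 * Real.pi) ^ n * (δ / (C + 1)) := by positivity
  filter_upwards [hh, hlim.eventually (gt_mem_nhds (ENNReal.ofReal_pos.2 hM))] with i hi hlt y
  refine (htransfer _ _ (windowRep_of_ulNorm_lt hk hi hM.le hlt) y).mono ?_
  rw [inv_mul_cancel_left₀ (by positivity), ← mul_div_assoc, div_le_iff₀ (by positivity)]
  nlinarith

theorem tendsto_ulNorm_of_eventually_windowRep (hk : IsL2Weight k) {h : ι → Sp n → ℂ}
    (hh : ∀ᶠ i in l, Continuous (h i))
    (hrep : ∀ δ : ℝ, 0 < δ → ∀ᶠ i in l, WindowRep k χ (h i) δ) :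
    Tendsto (fun i => ulNorm k χ (ofFun (h i))) l (𝓝 0) := by
  refine ENNReal.tendsto_nhds_zero.2 fun τ hτ => ?_
  obtain ⟨t, ht, htτ⟩ := ENNReal.lt_iff_exists_nnreal_btwn.1 hτ
  have ht0 : (0 : ℝ) < t := by exact_mod_cast ht
  filter_upwards [hh, hrep (((2 * Real.pi) ^ n)⁻¹ * t) (by positivity)] with i hi hδ
  refine (hδ.ulNorm_le hk hi).trans ?_
  rw [mul_inv_cancel_left₀ (by positivity), ENNReal.ofReal_coe_nnreal]
  exact htτ.le

theorem windowTendsto_of_tendsto_ulNorm (hk : IsL2Weight k) (hpol : IsKpol k) (hχ : χ ≠ 0) {d : ℕ}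
    {u : Fin d → Distr n} {f : Sp n → Fin d → ℂ} {v : ι → Fin d → Distr n}
    {g : ι → Sp n → Fin d → ℂ} (hf : IsContRep u f) (hg : ∀ᶠ i in l, IsContRep (v i) (g i))
    (hlim : ∀ j, Tendsto (fun i => ulNorm k χ (v i j - u j)) l (𝓝 0)) : WindowTendsto k g l f := by
  intro χ' δ hδ
  have hfc (j) : Continuous fun x => f x j := (continuous_apply j).comp hf.1
  refine eventually_all.2 fun j => eventually_windowRep_of_tendsto_ulNorm hk hpol hχ
    (h := fun i x => g i x j - f x j) ?_ ((hlim j).congr' ?_) χ' hδ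
  · exact hg.mono fun i hi => ((continuous_apply j).comp hi.1).sub (hfc j)
  · filter_upwards [hg] with i hi
    rw [hi.2 j, hf.2 j, ofFun_sub (f := fun x => g i x j) ((continuous_apply j).comp hi.1) (hfc j)]

theorem WindowTendsto.tendstoUniformly (hk : IsL2Weight k) {d : ℕ} {g : ι → Sp n → Fin d → ℂ}
    {f : Sp n → Fin d → ℂ} (hg : WindowTendsto k g l f) : TendstoUniformly g f l := by
  refine Metric.tendstoUniformly_iff.2 fun r hr => ?_
  obtain ⟨χ, hχ⟩ := exists_test_ne_zero n
  obtain ⟨x₀, hx₀⟩ := exists_test_apply_ne_zero hχ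
  have hk0 := invNorm_nonneg k
  have hχ0 : 0 < ‖χ x₀‖ := norm_pos_iff.2 hx₀
  filter_upwards [hg χ (r * ‖χ x₀‖ / (invNorm k + 1)) (by positivity)] with i hi x
  refine (dist_pi_lt_iff hr).2 fun j => ?_
  rw [dist_comm, dist_eq_norm]
  refine ((hi j).norm_le hk hx₀ x).trans_lt ?_
  rw [div_lt_iff₀ hχ0, ← mul_div_assoc, div_lt_iff₀ (by positivity)]
  nlinarith [mul_pos hr hχ0]

theorem eventually_closure_range_subset_of_tendstoUniformly {α β : Type*} [PseudoMetricSpace β]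
    {Ω : Set β} (hΩ : IsOpen Ω) {f : α → β} (hf : IsCompact (closure (Set.range f)))
    (hfΩ : closure (Set.range f) ⊆ Ω) {g : ι → α → β} (hg : TendstoUniformly g f l) :
    ∀ᶠ i in l, closure (Set.range (g i)) ⊆ Ω := by
  obtain ⟨r, hr, hrΩ⟩ := hf.exists_cthickening_subset_open hΩ hfΩ
  filter_upwards [Metric.tendstoUniformly_iff.1 hg r hr] with i hi
  refine (closure_minimal (Set.range_subset_iff.2 fun x => ?_)
    Metric.isClosed_cthickening).trans hrΩ
  exact Metric.mem_cthickening_of_dist_le _ (f x) r _ (subset_closure ⟨x, rfl⟩)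
    (dist_comm (f x) (g i x) ▸ (hi x).le)

end Convergence

section GlobalComposition

variable {ι : Type*} {l : Filter ι} {d : ℕ} {Ω : Set (Fin d → ℂ)} {Φ : (Fin d → ℂ) → ℂ}
  {k k' : Sp n → ℝ} {C : ℝ} {u : Fin d → Distr n} {f : Sp n → Fin d → ℂ}
  {g : ι → Sp n → Fin d → ℂ}

theorem continuous_comp_of_closure_range_subset {X : Type*} [TopologicalSpace X]
    (hΦ : DifferentiableOn ℂ Φ Ω) {f : X → Fin d → ℂ} (hf : Continuous f)
    (hfΩ : closure (Set.range f) ⊆ Ω) : Continuous fun x => Φ (f x) :=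
  hΦ.continuousOn.comp_continuous hf fun x => hfΩ (subset_closure ⟨x, rfl⟩)

theorem windowRep_sub_self (hk : IsL2Weight k) (χ : Test n) (f : Sp n → ℂ) {δ : ℝ}
    (hδ : 0 ≤ δ) : WindowRep k χ (fun x => f x - f x) δ := fun y => by
  simpa only [sub_self, mul_zero] using (FourierRep.zero hk).mono hδ

theorem WindowTendsto.rfl (hk : IsL2Weight k) : WindowTendsto k (fun _ => f) l f :=
  fun χ _ hδ => Eventually.of_forall fun _ _ => windowRep_sub_self hk χ _ hδ.le

theorem WindowTendsto.eventually_closure_range_subset (hΩ : IsOpen Ω) (hk : IsL2Weight k)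
    (hpol : IsKpol k) (hk' : IsL2Weight k') (hf : IsContRep u f) (hu : ∀ j, MemBInf k (u j))
    (hfΩ : closure (Set.range f) ⊆ Ω) (hgf : WindowTendsto k' g l f) :
    ∀ᶠ i in l, closure (Set.range (g i)) ⊆ Ω :=
  eventually_closure_range_subset_of_tendstoUniformly hΩ (hf.isCompact_closure_range hk hpol hu)
    hfΩ (hgf.tendstoUniformly hk')

theorem eventually_memBInf_comp (hΩ : IsOpen Ω) (hΦ : DifferentiableOn ℂ Φ Ω) (hk : IsL2Weight k)
    (hpol : IsKpol k) (hk' : IsAlgebraWeight k' C) (hpol' : IsKpol k')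
    (hlim : Tendsto (fun ξ => k' ξ / k ξ) (cocompact (Sp n)) (𝓝 0)) (hf : IsContRep u f)
    (hu : ∀ j, MemBInf k (u j)) (hfΩ : closure (Set.range f) ⊆ Ω)
    (hg : ∀ᶠ i in l, Continuous (g i)) (hgf : WindowTendsto k' g l f) :
    ∀ᶠ i in l, MemBInf k' (ofFun fun x => Φ (g i x)) := by
  obtain ⟨χ, hχ⟩ := exists_test_ne_zero n
  obtain ⟨χ₁, δ, C₁, C₂, hδ, -, hcomp⟩ :=
    exists_windowRep_comp hΩ hΦ hk hpol hk' hpol' hlim hf hu hfΩ χ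
  filter_upwards [hg, hgf χ₁ δ hδ, hgf.eventually_closure_range_subset hΩ hk hpol
    hk'.toIsL2Weight hf hu hfΩ] with i hi hrep hiΩ
  have hΦg := (hcomp (g i) (g i) 0 hrep hrep fun j =>
    windowRep_sub_self hk'.toIsL2Weight χ₁ _ le_rfl).1
  exact ⟨χ, hχ, (hΦg.ulNorm_le hk'.toIsL2Weight (continuous_comp_of_closure_range_subset hΦ hi
    hiΩ)).trans_lt ENNReal.ofReal_lt_top⟩

theorem tendsto_ulNorm_comp_sub (hΩ : IsOpen Ω) (hΦ : DifferentiableOn ℂ Φ Ω) (hk : IsL2Weight k)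
    (hpol : IsKpol k) (hk' : IsAlgebraWeight k' C) (hpol' : IsKpol k')
    (hlim : Tendsto (fun ξ => k' ξ / k ξ) (cocompact (Sp n)) (𝓝 0)) (hf : IsContRep u f)
    (hu : ∀ j, MemBInf k (u j)) (hfΩ : closure (Set.range f) ⊆ Ω)
    (hg : ∀ᶠ i in l, Continuous (g i)) (hgf : WindowTendsto k' g l f) (χ : Test n) :
    Tendsto (fun i => ulNorm k' χ ((ofFun fun x => Φ (g i x)) - ofFun fun x => Φ (f x)))
      l (𝓝 0) := by
  obtain ⟨χ₁, δ, C₁, C₂, hδ, hC₂, hcomp⟩ :=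
    exists_windowRep_comp hΩ hΦ hk hpol hk' hpol' hlim hf hu hfΩ χ
  have hΦf := continuous_comp_of_closure_range_subset hΦ hf.1 hfΩ
  have hΦg : ∀ᶠ i in l, Continuous fun x => Φ (g i x) := by
    filter_upwards [hg, hgf.eventually_closure_range_subset hΩ hk hpol hk'.toIsL2Weight hf hu hfΩ]
      with i hi hiΩ using continuous_comp_of_closure_range_subset hΦ hi hiΩ
  have hsub := tendsto_ulNorm_of_eventually_windowRep (χ := χ) hk'.toIsL2Weight
    (hΦg.mono fun i hi => hi.sub hΦf) fun τ hτ => by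
    filter_upwards [hgf χ₁ δ hδ, hgf χ₁ (τ / (C₂ + 1)) (by positivity)] with i hrep hrepτ y
    refine ((hcomp (g i) f _ hrep
      (fun j => windowRep_sub_self hk'.toIsL2Weight χ₁ _ hδ.le) hrepτ).2 y).mono ?_
    rw [← mul_div_assoc, div_le_iff₀ (by positivity)]
    nlinarith
  exact hsub.congr' (hΦg.mono fun i hi => congrArg _ (ofFun_sub hi hΦf).symm)

theorem memBInf_comp (hΩ : IsOpen Ω) (hΦ : DifferentiableOn ℂ Φ Ω) (hk : IsL2Weight k)
    (hpol : IsKpol k) (hk' : IsAlgebraWeight k' C) (hpol' : IsKpol k')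
    (hlim : Tendsto (fun ξ => k' ξ / k ξ) (cocompact (Sp n)) (𝓝 0)) (hf : IsContRep u f)
    (hu : ∀ j, MemBInf k (u j)) (hfΩ : closure (Set.range f) ⊆ Ω) :
    MemBInf k' (ofFun fun x => Φ (f x)) :=
  eventually_const.1 <| eventually_memBInf_comp (l := (⊤ : Filter Unit)) (g := fun _ => f) hΩ hΦ hk
    hpol hk' hpol' hlim hf hu hfΩ (Eventually.of_forall fun _ => hf.1)
    (WindowTendsto.rfl hk'.toIsL2Weight)

end GlobalComposition

end WienerLevy

end

theorem mainTheorem2_general {n d : ℕ} (Ω : Set (Fin d → ℂ)) (hΩ : IsOpen Ω)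
    (Φ : (Fin d → ℂ) → ℂ) (hΦ : DifferentiableOn ℂ Φ Ω)
    (k k' : Sp n → ℝ) (hk : IsKpol k) (hk' : IsKa k')
    (hlim : Tendsto (fun ξ => k' ξ / k ξ) (cocompact (Sp n)) (𝓝 0))
    (hL2 : MemLp (fun ξ => 1 / k' ξ) 2 volume) :
    (∀ u : Fin d → Distr n, (∀ j, MemBInf k (u j)) → ∃! f, IsContRep u f) ∧
    (∀ (u : Fin d → Distr n) (f : Sp n → Fin d → ℂ),
      (∀ j, MemBInf k (u j)) → IsContRep u f → closure (Set.range f) ⊆ Ω →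
      MemBInf k' (ofFun fun x => Φ (f x))) ∧
    (∀ (u : Fin d → Distr n) (f : Sp n → Fin d → ℂ)
      (uε : ℝ → Fin d → Distr n) (fε : ℝ → Sp n → Fin d → ℂ) (χ : Test n),
      (∀ j, MemBInf k (u j)) → IsContRep u f →
      (∀ ε ∈ Set.Ioc (0 : ℝ) 1, IsContRep (uε ε) (fε ε)) →
      closure (Set.range f) ⊆ Ω → χ ≠ 0 →
      (∀ j, Tendsto (fun ε => ulNorm k' χ (uε ε j - u j)) (𝓝[>] 0) (𝓝 0)) →
      ∃ ε₀ ∈ Set.Ioc (0 : ℝ) 1,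
        (∀ ε ∈ Set.Ioc 0 ε₀, closure (Set.range (fε ε)) ⊆ Ω ∧
          MemBInf k' (ofFun fun x => Φ (fε ε x))) ∧
        ∀ χ' : Test n,
          Tendsto (fun ε => ulNorm k' χ'
            ((ofFun fun x => Φ (fε ε x)) - ofFun fun x => Φ (f x))) (𝓝[>] 0) (𝓝 0)) := by
  obtain ⟨C, hA⟩ := hk'.exists_isAlgebraWeight hL2
  obtain ⟨c, hc⟩ := exists_le_mul_of_tendsto hk hk'.1 hlim
  have hW : IsL2Weight k := hA.toIsL2Weight.of_le_mul hk.1 hk.2.1 hc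
  refine ⟨fun u => existsUnique_isContRep hW,
    fun u f hu hf hfΩ => memBInf_comp hΩ hΦ hW hk hA hk'.1 hlim hf hu hfΩ,
    fun u f uε fε χ hu hf hfε hfΩ hχ hconv => ?_⟩
  have hrep : ∀ᶠ ε in 𝓝[>] (0 : ℝ), IsContRep (uε ε) (fε ε) := by
    filter_upwards [Ioc_mem_nhdsGT one_pos] using hfε
  have hcont : ∀ᶠ ε in 𝓝[>] (0 : ℝ), Continuous (fε ε) := hrep.mono fun _ h => h.1
  have hwin : WindowTendsto k' fε (𝓝[>] 0) f :=
    windowTendsto_of_tendsto_ulNorm hA.toIsL2Weight hk'.1 hχ hf hrep hconv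
  have hrange := hwin.eventually_closure_range_subset hΩ hW hk hA.toIsL2Weight hf hu hfΩ
  have hmem := eventually_memBInf_comp hΩ hΦ hW hk hA hk'.1 hlim hf hu hfΩ hcont hwin
  obtain ⟨a, ha, hsub⟩ := mem_nhdsGT_iff_exists_Ioc_subset.1 (hrange.and hmem)
  exact ⟨min a 1, ⟨lt_min ha one_pos, min_le_right _ _⟩,
    fun ε hε => hsub ⟨hε.1, hε.2.trans (min_le_left _ _)⟩,
    tendsto_ulNorm_comp_sub hΩ hΦ hW hk hA hk'.1 hlim hf hu hfΩ hcont hwin⟩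

/-- Part 1 makes the statement meaningful: a tuple in `(ℬ_k^∞)^d` is given by exactly one
continuous function `f : ℝⁿ → ℂ^d`, and `u(ℝⁿ)`, `Φ(u)` are `f(ℝⁿ)`, `Φ ∘ f`. Parts 2 and 3 are
the assertions (a) and (b). Convergence in `ℬ_{k'}^∞` is convergence in a norm `‖·‖_{k',∞,χ}`;
it is assumed for one nonzero `χ` and concluded for all of them. -/
theorem mainTheorem2 {n d : ℕ} (Ω : Set (Fin d → ℂ)) (hΩ : IsOpen Ω)
    (Φ : (Fin d → ℂ) → ℂ) (hΦ : DifferentiableOn ℂ Φ Ω)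
    (k k' : Sp n → ℝ) (hk : IsKpol k) (hk' : IsKa k')
    (hlim : Tendsto (fun ξ => k' ξ / k ξ) (cocompact (Sp n)) (𝓝 0))
    (hL2 : MemLp (fun ξ => 1 / k' ξ) 2 volume) :
    (∀ u : Fin d → Distr n, (∀ j, MemBInf k (u j)) → ∃! f, IsContRep u f) ∧
    (∀ (u : Fin d → Distr n) (f : Sp n → Fin d → ℂ),
      (∀ j, MemBInf k (u j)) → IsContRep u f → closure (Set.range f) ⊆ Ω →
      MemBInf k' (ofFun fun x => Φ (f x))) ∧
    (∀ (u : Fin d → Distr n) (f : Sp n → Fin d → ℂ)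
      (uε : ℝ → Fin d → Distr n) (fε : ℝ → Sp n → Fin d → ℂ) (χ : Test n),
      (∀ j, MemBInf k (u j)) → IsContRep u f →
      (∀ ε ∈ Set.Ioc (0 : ℝ) 1, (∀ j, MemBInf k (uε ε j)) ∧ IsContRep (uε ε) (fε ε)) →
      closure (Set.range f) ⊆ Ω → χ ≠ 0 →
      (∀ j, Tendsto (fun ε => ulNorm k' χ (uε ε j - u j)) (𝓝[>] 0) (𝓝 0)) →
      ∃ ε₀ ∈ Set.Ioc (0 : ℝ) 1,
        (∀ ε ∈ Set.Ioc 0 ε₀, closure (Set.range (fε ε)) ⊆ Ω ∧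
          MemBInf k' (ofFun fun x => Φ (fε ε x))) ∧
        ∀ χ' : Test n, χ' ≠ 0 →
          Tendsto (fun ε => ulNorm k' χ'
            ((ofFun fun x => Φ (fε ε x)) - ofFun fun x => Φ (f x))) (𝓝[>] 0) (𝓝 0)) := by
  obtain ⟨hunique, hmem, hconv⟩ := mainTheorem2_general Ω hΩ Φ hΦ k k' hk hk' hlim hL2
  refine ⟨hunique, hmem, fun u f uε fε χ hu hf huε hfΩ hχ hlimε => ?_⟩
  obtain ⟨ε₀, hε₀, hsub, htend⟩ := hconv u f uε fε χ hu hf (fun ε hε => (huε ε hε).2) hfΩ hχ hlimε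
  exact ⟨ε₀, hε₀, hsub, fun χ' _ => htend χ'⟩
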